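/- Notation. Let $\varphi(x)=\sqrt{1-x^2}$, let $\|\cdot\|_p$ be the norm of $L_p[-1,1]$, and let $E_n(f)_p$ be the infimum of $\|f-q\|_p$ over real algebraic polynomials $q$ of degree $<n$. Let $\mathbb B^0_p=L_p[-1,1]$. For $r\ge 1$ let $\mathbb B^r_p$ be the set of functions $f$ such that $f^{(r-1)}$ exists and is locally absolutely continuous in $(-1,1)$ and $\|f^{(r)}\varphi^r\|_p<\infty$. For $k\ge1$ and $h\ge 0$ put $$\Delta_h^k(g,x)=\sum_{i=0}^k\binom ki(-1)^{k-i}g\bigl(x+(i-k/2)h\bigr)\quad\text{if } x\pm kh/2\in[-1,1],$$ and $\Delta_h^k(g,x)=0$ otherwise. For $f\in\mathbb B_p^r$ put $$\omega^{\varphi}_{k,r}(f^{(r)},t)_p=\sup_{0\le h\le t}\bigl\|\mathcal W_{kh}^r(\cdot)\,\Delta^k_{h\varphi(\cdot)}(f^{(r)},\cdot)\bigr\|_p,\qquad \mathcal W_\delta(x)=\bigl((1-x-\delta\varphi(x)/2)(1+x-\delta\varphi(x)/2)\bigr)^{1/2}.$$ (The weight $\mathcal W_{kh}(x)$ matters only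 at those $x$ where both factors are nonnegative, since the difference vanishes at all other $x$.) Theorem. Let $1\le p\le\infty$, let $k\ge 1$, $r\ge 0$ and $N\ge 1$ be integers, and let $f\in L_p[-1,1]$. If $$\sum_{n=1}^\infty r n^{r-1}E_n(f)_p<\infty$$ (no condition if $r=0$), then, after modification on a null set, $f\in\mathbb B_p^r$ (so that, if $r\ge 1$, one of the representatives of $f$ has a locally absolutely continuous derivative $f^{(r-1)}$ in $(-1,1)$), and, for all $t\in[0,1/2]$, $$\omega_{k,r}^\varphi(f^{(r)},t)_p\le c\sum_{n>\max\{N,1/t\}}r n^{r-1}E_n(f)_p+c\,t^k\sum_{N\le n\le\max\{1/t,N\}}n^{k+r-1}E_n(f)_p+c(N)\,t^kE_{k+r}(f)_p .$$ If, in addition, $N\le k+r$, then, for all $t\in[0,1/2]$, $$\omega_{k,r}^\varphi(f^{(r)},t)_p\le c\sum_{n>\max\{N,1/t\}}r n^{r-1}E_n(f)_p+c\,t^k\sum_{N\le n\le\max\{1/t,N\}}n^{k+r-1}E_n(f)_p .$$ Here $c$ is a constant that depends only on $k,r,p$, and $c(N)$ is a constant that depends only on $k,r,p,N$. For $t=0$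 we read $1/t=\infty$, so that the right-hand sides are $0$ (with $0\cdot\infty=0$). -/

import Mathlib

open MeasureTheory Set
open scoped ENNReal NNReal

noncomputable section

/-- Lebesgue measure on `[-1, 1]`. -/
def mu : Measure ℝ := volume.restrict (Icc (-1 : ℝ) 1)

/-- The function `φ(x) = √(1 - x²)`. -/
def phi (x : ℝ) : ℝ := Real.sqrt (1 - x ^ 2)

open Classical in
/-- The `k`-th symmetric difference `Δ_h^k(f, x, J)`; it is `0` unless both endpoints
`x ± kh/2` lie in `J`. -/
def symmDifference (k : ℕ) (h : ℝ) (f : ℝ → ℝ) (x : ℝ) (J : Set ℝ) : ℝ :=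
  if x + k * h / 2 ∈ J ∧ x - k * h / 2 ∈ J then
    ∑ i ∈ Finset.range (k + 1),
      (k.choose i : ℝ) * (-1) ^ (k - i) * f (x + ((i : ℝ) - (k : ℝ) / 2) * h)
  else 0

/-- The weight `((1 - x - δφ(x)/2) (1 + x - δφ(x)/2))^{1/2}`. It is only used where
both factors are nonnegative. -/
def weight (δ x : ℝ) : ℝ :=
  Real.sqrt ((1 - x - δ * phi x / 2) * (1 + x - δ * phi x / 2))

/-- Membership in the class `𝔹_p^r`: for `r ≥ 1`, the function `f` has a derivative of order
`r - 1` in `(-1, 1)` which is locally absolutely continuous there (in particular continuous), and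
`f^{(r)} φ^r ∈ L_p[-1, 1]`, where `f^{(r)}` is the almost everywhere existing derivative
of `f^{(r-1)}`. For `r = 0` this is membership in `L_p[-1, 1]`. -/
def MemB (p : ℝ≥0∞) (r : ℕ) (f : ℝ → ℝ) : Prop :=
  (1 ≤ r →
    ContDiffOn ℝ ((r - 1 : ℕ) : WithTop ℕ∞) f (Ioo (-1) 1) ∧
    ∀ a b : ℝ, -1 < a → a ≤ b → b < 1 →
      AbsolutelyContinuousOnInterval (iteratedDeriv (r - 1) f) a b) ∧
  MemLp (fun x => iteratedDeriv r f x * phi x ^ r) p mu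

/-- The modulus of smoothness `ω_{k,r}^φ(g, t)_p`, to be applied to `g = f^{(r)}`. -/
def modulus (k r : ℕ) (p : ℝ≥0∞) (g : ℝ → ℝ) (t : ℝ) : ℝ≥0∞ :=
  ⨆ h ∈ Icc (0 : ℝ) t,
    eLpNorm (fun x => weight (k * h) x ^ r * symmDifference k (h * phi x) g x (Icc (-1) 1)) p mu

/-- The degree of approximation `E_n(f)_p` of `f` in `L_p[-1, 1]` by algebraic polynomials
of degree `< n`. -/
def approxError (n : ℕ) (f : ℝ → ℝ) (p : ℝ≥0∞) : ℝ≥0∞ :=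
  ⨅ q ∈ Polynomial.degreeLT ℝ n, eLpNorm (fun x => f x - q.eval x) p mu

end

/-! The theorem is an inverse theorem, and it rests on Bernstein's inequality with weights,
`eLpNorm_iterate_derivative_mul_phi_pow_le`: the norm of Q^(m) φ^m is at most (6n)^m times that of Q
when deg Q ≤ n, for every p ≥ 1.

This inequality is obtained on the sphere. The functions (x+iy)^m Q(z) have modulus |Q(z)| φ(z)^m
there, and by Archimedes the height z is uniformly distributed on [-1,1], so their L_p norms are
weighted norms of Q. If B and A are the infinitesimal rotations in the (x,z) and (y,z) planes, B +
iA sends (x+iy)^m Q(z) to (x+iy)^(m+1) Q'(z). Along a rotation the function is a trigonometric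
polynomial of degree at most n, whose derivative is a finite combination of rotated values with
total weight O(n). As rotations preserve the norm, the triangle inequality finishes the argument.

Two estimates for the weighted difference follow. For arbitrary g it is bounded by the norm of g φ^r
(`eLpNorm_weightedDiff_le`), since x ↦ x + cφ(x) distorts measure by at most 2 and the weight is at
most φ at the shifted point. For g = q^(r) with deg q < n it is O(h^k n^(k+r)) times the norm of q
(`eLpNorm_weightedDiff_polynomial_le`), by Taylor expansion and Bernstein's inequality term by term.

Let q_n be near-best polynomials. The series telescoping along q_(2^j) converges, with its
derivatives up to order r in weighted L_p, to a smooth representative of f. With M = max(N, ⌊1/t⌋),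
write f^(r) = (f - q_M)^(r) + (q_M - q_N)^(r) + q_N^(r). The first estimate handles the first term,
the second one the middle term, and dyadic summation (`dist_le_of_dyadic`) turns the crude powers
into the stated sums. The last term vanishes under the difference if N ≤ k+r; otherwise q_(k+r) is
subtracted from it, which produces c(N). -/

/-! ### Trigonometric polynomials -/

open Polynomial in
/-- `G` is a trigonometric polynomial of degree at most `n`. -/
def IsTrigPoly (n : ℕ) (G : ℝ → ℂ) : Prop :=
  ∃ A : ℂ[X], A.natDegree ≤ 2 * n ∧
    ∀ t : ℝ, G t * Complex.exp (t * Complex.I) ^ n = A.eval (Complex.exp (t * Complex.I))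

namespace IsTrigPoly
open Polynomial

lemma mul {m n : ℕ} {F G : ℝ → ℂ} (hF : IsTrigPoly m F) (hG : IsTrigPoly n G) :
    IsTrigPoly (m + n) (fun t => F t * G t) := by
  obtain ⟨A, hA, hFA⟩ := hF
  obtain ⟨B, hB, hGB⟩ := hG
  refine ⟨A * B, natDegree_mul_le.trans (by omega), fun t => ?_⟩
  rw [eval_mul, ← hFA, ← hGB, pow_add]
  ring

lemma add {n : ℕ} {F G : ℝ → ℂ} (hF : IsTrigPoly n F) (hG : IsTrigPoly n G) :
    IsTrigPoly n (fun t => F t + G t) := by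
  obtain ⟨A, hA, hFA⟩ := hF
  obtain ⟨B, hB, hGB⟩ := hG
  refine ⟨A + B, (natDegree_add_le _ _).trans (by omega), fun t => ?_⟩
  rw [eval_add, ← hFA, ← hGB]
  ring

lemma const (c : ℂ) : IsTrigPoly 0 (fun _ => c) := ⟨C c, by simp, fun t => by simp⟩

lemma mono {m n : ℕ} (hmn : m ≤ n) {F : ℝ → ℂ} (hF : IsTrigPoly m F) : IsTrigPoly n F := by
  obtain ⟨A, hA, hFA⟩ := hF
  refine ⟨A * X ^ (n - m), natDegree_mul_le.trans ?_, fun t => ?_⟩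
  · rw [natDegree_X_pow]; omega
  · rw [eval_mul, ← hFA, eval_pow, eval_X, mul_assoc, ← pow_add, Nat.add_sub_cancel' hmn]

lemma pow {n : ℕ} {F : ℝ → ℂ} (hF : IsTrigPoly n F) (m : ℕ) :
    IsTrigPoly (m * n) (fun t => F t ^ m) := by
  induction m with
  | zero => simpa using const 1
  | succ m ih => simpa [pow_succ, Nat.succ_mul] using ih.mul hF

lemma sum {ι : Type*} (s : Finset ι) {n : ℕ} {F : ι → ℝ → ℂ} (hF : ∀ i ∈ s, IsTrigPoly n (F i)) :
    IsTrigPoly n (fun t => ∑ i ∈ s, F i t) := by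
  classical
  induction s using Finset.induction_on with
  | empty => simpa using (const 0).mono (Nat.zero_le n)
  | insert a s ha ih =>
    simp_rw [Finset.sum_insert ha]
    exact (hF a (by simp)).add (ih fun i hi => hF i (by simp [hi]))

lemma cos_sin (a b : ℂ) : IsTrigPoly 1 (fun t => a * Real.cos t + b * Real.sin t) := by
  refine ⟨C ((a - Complex.I * b) / 2) * X ^ 2 + C ((a + Complex.I * b) / 2), ?_, fun t => ?_⟩
  · compute_degree
  · have h : Complex.exp (t * Complex.I) = Complex.cos t + Complex.sin t * Complex.I :=
      Complex.exp_mul_I _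
    have h1 : Complex.cos t ^ 2 + Complex.sin t ^ 2 = 1 := Complex.cos_sq_add_sin_sq _
    have hI : Complex.I ^ 2 = -1 := Complex.I_sq
    simp only [pow_one, eval_add, eval_mul, eval_C, eval_pow, eval_X, h, Complex.ofReal_cos,
      Complex.ofReal_sin]
    linear_combination ((a + Complex.I * b) / 2) * h1 +
      (Complex.sin t ^ 2 * (- a + Complex.I * b) / 2 + Complex.cos t * Complex.sin t * b) * hI

lemma polynomial_eval {F : ℝ → ℂ} (hF : IsTrigPoly 1 F) (Q : ℂ[X]) {n : ℕ} (hQ : Q.natDegree ≤ n) :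
    IsTrigPoly n (fun t => Q.eval (F t)) := by
  simp_rw [eval_eq_sum_range]
  refine sum _ fun i hi => ?_
  have hi' : i ≤ n := by rw [Finset.mem_range] at hi; omega
  have := (const (Q.coeff i)).mul (hF.pow i)
  exact this.mono (by omega)

end IsTrigPoly

/-! ### Bernstein's interpolation formula through the Fejér kernel -/

lemma sum_zpow_rootOfUnity {M : ℕ} {ζ : ℂ} (hζ : IsPrimitiveRoot ζ M) (ν : ℤ)
    (hν : |ν| < M) : ∑ k ∈ Finset.range M, (ζ ^ k) ^ ν = if ν = 0 then (M : ℂ) else 0 := by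
  split_ifs with h
  · simp [h]
  · have h1 : ζ ^ ν ≠ 1 := by
      rw [Ne, hζ.zpow_eq_one_iff_dvd]
      intro hd
      exact h (Int.eq_zero_of_abs_lt_dvd hd hν)
    have h2 : ∀ k : ℕ, (ζ ^ k) ^ ν = (ζ ^ ν) ^ k := fun k => by
      rw [← zpow_natCast, ← zpow_natCast, ← zpow_mul, ← zpow_mul, mul_comm]
    simp_rw [h2]
    rw [geom_sum_eq h1, ← zpow_natCast, ← zpow_mul, mul_comm, zpow_mul, zpow_natCast, hζ.pow_eq_one]
    simp

/-- With D = 1 + z + … + z^(d-1), the coefficient of z^(d-l) in |D|² on the unit circle is l. All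
exponents that occur are smaller than 2d+1 in modulus, so averaging over the roots of unity extracts
this coefficient exactly. -/
lemma sum_fejer_mul_pow {d : ℕ} {ζ : ℂ} (hζ : IsPrimitiveRoot ζ (2 * d + 1)) {l : ℕ} (hl : l ≤ d) :
    ∑ k ∈ Finset.range (2 * d + 1), ((ζ ^ k) ^ (-(d : ℤ)) * ((∑ a ∈ Finset.range d, (ζ ^ k) ^ a) *
      ∑ b ∈ Finset.range d, (ζ ^ k) ^ (-(b : ℤ)))) * (ζ ^ k) ^ l = (2 * d + 1) * l := by
  have h0 : ζ ≠ 0 := hζ.ne_zero (by omega)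
  have h1 : ∀ k ∈ Finset.range (2 * d + 1),
      ((ζ ^ k) ^ (-(d : ℤ)) * ((∑ a ∈ Finset.range d, (ζ ^ k) ^ a) *
      ∑ b ∈ Finset.range d, (ζ ^ k) ^ (-(b : ℤ)))) * (ζ ^ k) ^ l =
      ∑ a ∈ Finset.range d, ∑ b ∈ Finset.range d, (ζ ^ k) ^ ((l : ℤ) - d + a - b) := by
    intro k _
    have hk : ζ ^ k ≠ 0 := pow_ne_zero _ h0
    rw [Finset.sum_mul_sum, Finset.mul_sum, Finset.sum_mul]
    refine Finset.sum_congr rfl fun a _ => ?_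
    rw [Finset.mul_sum, Finset.sum_mul]
    refine Finset.sum_congr rfl fun b _ => ?_
    rw [← zpow_natCast (ζ ^ k) a, ← zpow_natCast (ζ ^ k) l, ← zpow_add₀ hk, ← zpow_add₀ hk,
      ← zpow_add₀ hk]
    congr 1
    ring
  rw [Finset.sum_congr rfl h1, Finset.sum_comm]
  have h2 : ∀ a ∈ Finset.range d, ∑ k ∈ Finset.range (2 * d + 1), ∑ b ∈ Finset.range d,
      (ζ ^ k) ^ ((l : ℤ) - d + a - b) = if d ≤ l + a then (2 * d + 1 : ℂ) else 0 := by
    intro a ha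
    rw [Finset.mem_range] at ha
    rw [Finset.sum_comm]
    have h3 : ∀ b ∈ Finset.range d, ∑ k ∈ Finset.range (2 * d + 1),
        (ζ ^ k) ^ ((l : ℤ) - d + a - b) =
        if b = l + a - d ∧ d ≤ l + a then (2 * d + 1 : ℂ) else 0 := by
      intro b hb
      rw [Finset.mem_range] at hb
      rw [sum_zpow_rootOfUnity hζ _ (by rw [abs_lt]; constructor <;> push_cast <;> omega)]
      push_cast
      refine if_congr (by omega) rfl rfl
    rw [Finset.sum_congr rfl h3]
    simp_rw [ite_and]
    rw [Finset.sum_ite_eq', if_pos (Finset.mem_range.2 (by omega))]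
  rw [Finset.sum_congr rfl h2, ← Finset.sum_filter, Finset.sum_const]
  have h4 : (Finset.range d).filter (fun a => d ≤ l + a) = Finset.Ico (d - l) d := by
    ext a
    simp only [Finset.mem_filter, Finset.mem_range, Finset.mem_Ico]
    omega
  rw [h4, Nat.card_Ico, nsmul_eq_mul, Nat.sub_sub_self hl, mul_comm]

/-- Parseval for D. As the Fejér weights are nonnegative up to a unimodular factor, this computes
the total weight of the interpolation formula. -/
lemma sum_fejer {d : ℕ} {ζ : ℂ} (hζ : IsPrimitiveRoot ζ (2 * d + 1)) :
    ∑ k ∈ Finset.range (2 * d + 1), ‖∑ a ∈ Finset.range d, (ζ ^ k) ^ a‖ ^ 2 = (2 * d + 1) * d := by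
  have h0 : ζ ≠ 0 := hζ.ne_zero (by omega)
  have hn : ‖ζ‖ = 1 := hζ.norm'_eq_one (by omega)
  have key : ∑ k ∈ Finset.range (2 * d + 1), ((‖∑ a ∈ Finset.range d, (ζ ^ k) ^ a‖ ^ 2 : ℝ) : ℂ) =
      (2 * d + 1) * d := by
    have h1 : ∀ k ∈ Finset.range (2 * d + 1),
        ((‖∑ a ∈ Finset.range d, (ζ ^ k) ^ a‖ ^ 2 : ℝ) : ℂ) =
        ∑ a ∈ Finset.range d, ∑ b ∈ Finset.range d, (ζ ^ k) ^ ((a : ℤ) - b) := by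
      intro k _
      have hk : ζ ^ k ≠ 0 := pow_ne_zero _ h0
      have hk1 : ‖ζ ^ k‖ = 1 := by rw [norm_pow, hn, one_pow]
      push_cast
      rw [← Complex.mul_conj', map_sum, Finset.sum_mul_sum]
      refine Finset.sum_congr rfl fun a _ => Finset.sum_congr rfl fun b _ => ?_
      rw [map_pow, ← Complex.inv_eq_conj hk1, zpow_sub₀ hk, zpow_natCast, zpow_natCast,
        div_eq_mul_inv, inv_pow]
    rw [Finset.sum_congr rfl h1, Finset.sum_comm]
    have h2 : ∀ a ∈ Finset.range d, ∑ k ∈ Finset.range (2 * d + 1), ∑ b ∈ Finset.range d,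
        (ζ ^ k) ^ ((a : ℤ) - b) = (2 * d + 1 : ℂ) := by
      intro a ha
      rw [Finset.sum_comm]
      have h3 : ∀ b ∈ Finset.range d, ∑ k ∈ Finset.range (2 * d + 1),
          (ζ ^ k) ^ ((a : ℤ) - b) = if a = b then (2 * d + 1 : ℂ) else 0 := by
        intro b hb
        rw [Finset.mem_range] at hb ha
        rw [sum_zpow_rootOfUnity hζ _ (by rw [abs_lt]; constructor <;> push_cast <;> omega)]
        push_cast
        refine if_congr (by omega) rfl rfl
      rw [Finset.sum_congr rfl h3, Finset.sum_ite_eq, if_pos ha]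
    rw [Finset.sum_congr rfl h2, Finset.sum_const, Finset.card_range, nsmul_eq_mul, mul_comm]
  exact_mod_cast key

open Polynomial in
/-- The derivative of a polynomial of degree at most `d` at `1`, as a combination of its values at
roots of unity with total weight at most `d`. -/
lemma exists_derivative_eval_one_eq (d : ℕ) : ∃ (t : ℕ → ℝ) (c : ℕ → ℂ),
    ∑ k ∈ Finset.range (2 * d + 1), ‖c k‖ ≤ d ∧
    ∀ A : ℂ[X], A.natDegree ≤ d → A.derivative.eval 1 =
      ∑ k ∈ Finset.range (2 * d + 1), c k * A.eval (Complex.exp (t k * Complex.I)) := by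
  have hζ := Complex.isPrimitiveRoot_exp (2 * d + 1) (by omega)
  set ζ := Complex.exp (2 * Real.pi * Complex.I / (2 * d + 1 : ℕ)) with hζdef
  have hn : ‖ζ‖ = 1 := hζ.norm'_eq_one (by omega)
  have hd0 : ((2 : ℂ) * d + 1) ≠ 0 := by exact_mod_cast (by omega : 2 * d + 1 ≠ 0)
  have hd1 : ((2 : ℝ) * d + 1) ≠ 0 := by positivity
  -- The weight at ζ^k is ζ^(-dk) |D(ζ^k)|² / (2d+1); the sum over `b` is the conjugate of D(ζ^k)
  -- because |ζ| = 1.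
  refine ⟨fun k => k * (2 * Real.pi / (2 * d + 1)), fun k => (2 * d + 1 : ℂ)⁻¹ *
    ((ζ ^ k) ^ (-(d : ℤ)) * ((∑ a ∈ Finset.range d, (ζ ^ k) ^ a) *
      ∑ b ∈ Finset.range d, (ζ ^ k) ^ (-(b : ℤ)))), ?_, ?_⟩
  · have h1 : ∀ k ∈ Finset.range (2 * d + 1), ‖((2 * d + 1 : ℂ))⁻¹ *
        ((ζ ^ k) ^ (-(d : ℤ)) * ((∑ a ∈ Finset.range d, (ζ ^ k) ^ a) *
        ∑ b ∈ Finset.range d, (ζ ^ k) ^ (-(b : ℤ))))‖ =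
        (2 * d + 1 : ℝ)⁻¹ * ‖∑ a ∈ Finset.range d, (ζ ^ k) ^ a‖ ^ 2 := by
      intro k _
      have hk1 : ‖ζ ^ k‖ = 1 := by rw [norm_pow, hn, one_pow]
      have h2 : (∑ b ∈ Finset.range d, (ζ ^ k) ^ (-(b : ℤ))) =
          (starRingEnd ℂ) (∑ a ∈ Finset.range d, (ζ ^ k) ^ a) := by
        rw [map_sum]
        refine Finset.sum_congr rfl fun b _ => ?_
        rw [map_pow, ← Complex.inv_eq_conj hk1, zpow_neg, zpow_natCast, inv_pow (ζ ^ k) b]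
      have h3 : ‖(2 * d + 1 : ℂ)‖ = 2 * d + 1 := by
        have : (2 * d + 1 : ℂ) = ((2 * d + 1 : ℕ) : ℂ) := by push_cast; ring
        rw [this, Complex.norm_natCast]; push_cast; ring
      rw [h2, norm_mul, norm_mul, norm_mul, norm_inv, h3, norm_zpow, hk1, one_zpow, one_mul,
        RCLike.norm_conj, sq]
    rw [Finset.sum_congr rfl h1, ← Finset.mul_sum, sum_fejer hζ, ← mul_assoc,
      inv_mul_cancel₀ hd1, one_mul]
  · intro A hA
    have hexp : ∀ k : ℕ, Complex.exp (((k * (2 * Real.pi / (2 * d + 1)) : ℝ) : ℂ) * Complex.I) =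
        ζ ^ k := by
      intro k
      rw [hζdef, ← Complex.exp_nat_mul]
      congr 1
      push_cast
      ring
    simp_rw [hexp]
    rw [derivative_eval, sum_over_range' _ (by simp) (d + 1) (by omega)]
    have h1 : ∀ k ∈ Finset.range (2 * d + 1), (2 * d + 1 : ℂ)⁻¹ *
        ((ζ ^ k) ^ (-(d : ℤ)) * ((∑ a ∈ Finset.range d, (ζ ^ k) ^ a) *
        ∑ b ∈ Finset.range d, (ζ ^ k) ^ (-(b : ℤ)))) * A.eval (ζ ^ k) =
        ∑ l ∈ Finset.range (d + 1), (2 * d + 1 : ℂ)⁻¹ * A.coeff l *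
        (((ζ ^ k) ^ (-(d : ℤ)) * ((∑ a ∈ Finset.range d, (ζ ^ k) ^ a) *
        ∑ b ∈ Finset.range d, (ζ ^ k) ^ (-(b : ℤ)))) * (ζ ^ k) ^ l) := by
      intro k _
      rw [eval_eq_sum_range' (n := d + 1) (by omega), Finset.mul_sum]
      refine Finset.sum_congr rfl fun l _ => ?_
      ring
    rw [Finset.sum_congr rfl h1, Finset.sum_comm]
    refine Finset.sum_congr rfl fun l hl => ?_
    rw [Finset.mem_range] at hl
    rw [← Finset.mul_sum, sum_fejer_mul_pow hζ (by omega), one_pow, mul_one]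
    field_simp

/-- A Bernstein type formula: the derivative of a trigonometric polynomial of degree `n` at `0` is
a combination of finitely many of its values with total weight at most `3 n`. -/
lemma exists_deriv_trigPoly_eq (n : ℕ) : ∃ (s : Finset ℕ) (t : ℕ → ℝ) (c : ℕ → ℂ),
    ∑ k ∈ s, ‖c k‖ ≤ 3 * n ∧
    ∀ G : ℝ → ℂ, IsTrigPoly n G → HasDerivAt G (∑ k ∈ s, c k * G (t k)) 0 := by
  obtain ⟨t, c, hc, h⟩ := exists_derivative_eval_one_eq (2 * n)
  -- Write G(t) = e^(-int) A(e^(it)) with deg A ≤ 2n. Differentiating A costs weight 2n;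
  -- differentiating the factor gives -in G(0), placed at one extra node t = 0, of weight n.
  refine ⟨Finset.range (2 * (2 * n) + 1 + 1),
    fun k => if k = 2 * (2 * n) + 1 then 0 else t k,
    fun k => if k = 2 * (2 * n) + 1 then -(n * Complex.I) else
      Complex.I * Complex.exp (t k * Complex.I) ^ n * c k, ?_, ?_⟩
  · rw [Finset.sum_range_succ]
    beta_reduce
    rw [if_pos rfl]
    have h1 : ∀ k ∈ Finset.range (2 * (2 * n) + 1), ‖(if k = 2 * (2 * n) + 1 then -(n * Complex.I)
        else Complex.I * Complex.exp (t k * Complex.I) ^ n * c k)‖ = ‖c k‖ := by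
      intro k hk
      rw [Finset.mem_range] at hk
      rw [if_neg (by omega), norm_mul, norm_mul, Complex.norm_I, norm_pow,
        Complex.norm_exp_ofReal_mul_I, one_pow, one_mul, one_mul]
    rw [Finset.sum_congr rfl h1]
    have : ‖-((n : ℂ) * Complex.I)‖ = n := by simp
    rw [this]
    push_cast at hc
    linarith
  · rintro G ⟨A, hA, hGA⟩
    have hG : G = fun t : ℝ => Complex.exp (t * Complex.I) ^ (-(n : ℤ)) *
        A.eval (Complex.exp (t * Complex.I)) := by
      funext t
      rw [← hGA, zpow_neg, zpow_natCast]
      field_simp [Complex.exp_ne_zero]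
    have hexp : HasDerivAt (fun t : ℝ => Complex.exp (t * Complex.I)) Complex.I 0 := by
      have h1 : HasDerivAt (fun t : ℝ => (t : ℂ) * Complex.I) (1 * Complex.I) 0 :=
        (Complex.ofRealCLM.hasDerivAt (x := (0 : ℝ))).mul_const _
      simpa using h1.cexp
    have hA' : HasDerivAt (fun t : ℝ => A.eval (Complex.exp (t * Complex.I)))
        (A.derivative.eval 1 * Complex.I) 0 := by
      have h1 := A.hasDerivAt (Complex.exp (((0 : ℝ) : ℂ) * Complex.I))
      have := h1.comp (0 : ℝ) hexp
      simpa [Function.comp_def] using this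
    have hz : HasDerivAt (fun t : ℝ => Complex.exp (t * Complex.I) ^ (-(n : ℤ)))
        (-n * Complex.I) 0 := by
      have h1 := hasDerivAt_zpow (-(n : ℤ)) (Complex.exp (((0 : ℝ) : ℂ) * Complex.I))
        (Or.inl (Complex.exp_ne_zero _))
      have := h1.comp (0 : ℝ) hexp
      simpa [Function.comp_def] using this
    have hder := hz.mul hA'
    rw [Finset.sum_range_succ]
    beta_reduce
    rw [if_pos rfl, if_pos rfl]
    have h0 : G 0 = A.eval 1 := by rw [hG]; simp
    have hder' := hder.congr_of_eventuallyEq (Filter.Eventually.of_forall (congrFun hG))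
    refine hder'.congr_deriv ?_
    rw [h A hA]
    have h2 : ∀ k ∈ Finset.range (2 * (2 * n) + 1), (if k = 2 * (2 * n) + 1 then -(n * Complex.I)
        else Complex.I * Complex.exp (t k * Complex.I) ^ n * c k) *
        G (if k = 2 * (2 * n) + 1 then 0 else t k) =
        Complex.I * (c k * A.eval (Complex.exp (t k * Complex.I))) := by
      intro k hk
      rw [Finset.mem_range] at hk
      rw [if_neg (by omega), if_neg (by omega), ← hGA]
      ring
    rw [Finset.sum_congr rfl h2, ← Finset.mul_sum, h0]
    simp
    ring

/-! ### Rotations of the unit ball in three dimensions -/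

/-- The squared Euclidean norm on `(ℝ × ℝ) × ℝ`. -/
def normSq3 (x : (ℝ × ℝ) × ℝ) : ℝ := x.1.1 ^ 2 + x.1.2 ^ 2 + x.2 ^ 2

/-- Lebesgue measure on the Euclidean unit ball of `(ℝ × ℝ) × ℝ`. -/
noncomputable def ballMeasure : Measure ((ℝ × ℝ) × ℝ) := volume.restrict {x | normSq3 x ≤ 1}

/-- The radial projection onto the unit sphere. -/
noncomputable def radialProj (x : (ℝ × ℝ) × ℝ) : (ℝ × ℝ) × ℝ := (Real.sqrt (normSq3 x))⁻¹ • x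

lemma continuous_normSq3 : Continuous normSq3 := by unfold normSq3; fun_prop

lemma measurable_radialProj : Measurable radialProj := by
  unfold radialProj
  exact (continuous_normSq3.measurable.sqrt.inv).smul measurable_id

lemma measurableSet_unitBall3 : MeasurableSet {x | normSq3 x ≤ 1} :=
  measurableSet_le continuous_normSq3.measurable measurable_const

lemma normSq3_nonneg (x : (ℝ × ℝ) × ℝ) : 0 ≤ normSq3 x := by unfold normSq3; positivity

/-- Rotation of the plane by the angle `t`. -/
noncomputable def rot2 (t : ℝ) (x : ℝ × ℝ) : ℝ × ℝ :=
  (x.1 * Real.cos t - x.2 * Real.sin t, x.1 * Real.sin t + x.2 * Real.cos t)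

lemma measurePreserving_rot2 (t : ℝ) : MeasurePreserving (rot2 t) volume volume := by
  set f : ℝ × ℝ →ₗ[ℝ] ℝ × ℝ := Matrix.toLin (Module.Basis.finTwoProd ℝ) (Module.Basis.finTwoProd ℝ)
    !![Real.cos t, -Real.sin t; Real.sin t, Real.cos t] with hf
  have hdet : LinearMap.det f = 1 := by
    rw [hf, LinearMap.det_toLin, Matrix.det_fin_two_of]
    linear_combination Real.cos_sq_add_sin_sq t
  have hfr : ⇑f = rot2 t := by
    funext x
    rw [hf, Matrix.toLin_finTwoProd_apply]
    simp only [rot2, Prod.mk.injEq]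
    constructor <;> ring
  refine ⟨by unfold rot2; fun_prop, ?_⟩
  have := Measure.map_linearMap_addHaar_eq_smul_addHaar (volume : Measure (ℝ × ℝ)) (f := f)
    (by rw [hdet]; exact one_ne_zero)
  rw [hfr, hdet] at this
  simpa using this

/-- Rotation about the first coordinate axis. -/
noncomputable def rotA (t : ℝ) (x : (ℝ × ℝ) × ℝ) : (ℝ × ℝ) × ℝ :=
  ((x.1.1, x.1.2 * Real.cos t - x.2 * Real.sin t), x.1.2 * Real.sin t + x.2 * Real.cos t)

/-- Rotation about the second coordinate axis. -/
noncomputable def rotB (t : ℝ) (x : (ℝ × ℝ) × ℝ) : (ℝ × ℝ) × ℝ :=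
  ((x.1.1 * Real.cos t - x.2 * Real.sin t, x.1.2), x.1.1 * Real.sin t + x.2 * Real.cos t)

lemma measurePreserving_rotA (t : ℝ) : MeasurePreserving (rotA t) volume volume := by
  have h := (volume_preserving_prodAssoc (α₁ := ℝ) (β₁ := ℝ) (γ₁ := ℝ)).symm.comp
    (((MeasurePreserving.id (volume : Measure ℝ)).prod (measurePreserving_rot2 t)).comp
      (volume_preserving_prodAssoc (α₁ := ℝ) (β₁ := ℝ) (γ₁ := ℝ)))
  exact h

lemma measurePreserving_rotB (t : ℝ) : MeasurePreserving (rotB t) volume volume := by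
  have hs : MeasurePreserving (Prod.map Prod.swap id : (ℝ × ℝ) × ℝ → (ℝ × ℝ) × ℝ) volume volume :=
    (Measure.measurePreserving_swap (μ := (volume : Measure ℝ)) (ν := (volume : Measure ℝ))).prod
      (MeasurePreserving.id (volume : Measure ℝ))
  exact hs.comp ((measurePreserving_rotA t).comp hs)

lemma normSq3_rotA (t : ℝ) (x : (ℝ × ℝ) × ℝ) : normSq3 (rotA t x) = normSq3 x := by
  simp only [normSq3, rotA]
  linear_combination (x.1.2 ^ 2 + x.2 ^ 2) * Real.cos_sq_add_sin_sq t

lemma normSq3_rotB (t : ℝ) (x : (ℝ × ℝ) × ℝ) : normSq3 (rotB t x) = normSq3 x := by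
  simp only [normSq3, rotB]
  linear_combination (x.1.1 ^ 2 + x.2 ^ 2) * Real.cos_sq_add_sin_sq t

lemma measurePreserving_ballMeasure_rotA (t : ℝ) :
    MeasurePreserving (rotA t) ballMeasure ballMeasure := by
  have := (measurePreserving_rotA t).restrict_preimage measurableSet_unitBall3
  have h : rotA t ⁻¹' {x | normSq3 x ≤ 1} = {x | normSq3 x ≤ 1} := by
    ext x
    simp only [mem_preimage, mem_ofPred_eq, normSq3_rotA]
  rw [h] at this
  exact this

lemma measurePreserving_ballMeasure_rotB (t : ℝ) :
    MeasurePreserving (rotB t) ballMeasure ballMeasure := by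
  have := (measurePreserving_rotB t).restrict_preimage measurableSet_unitBall3
  have h : rotB t ⁻¹' {x | normSq3 x ≤ 1} = {x | normSq3 x ≤ 1} := by
    ext x
    simp only [mem_preimage, mem_ofPred_eq, normSq3_rotB]
  rw [h] at this
  exact this

lemma radialProj_rotA (t : ℝ) (x : (ℝ × ℝ) × ℝ) :
    radialProj (rotA t x) = rotA t (radialProj x) := by
  rw [radialProj, normSq3_rotA, radialProj]
  ext <;> simp [rotA] <;> ring

lemma radialProj_rotB (t : ℝ) (x : (ℝ × ℝ) × ℝ) :
    radialProj (rotB t x) = rotB t (radialProj x) := by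
  rw [radialProj, normSq3_rotB, radialProj]
  ext <;> simp [rotB] <;> ring

/-! ### The marginal of the uniform measure on the sphere -/

/-- Substitute z = √s u/φ(u), the inverse of u = z/√(s+z²), with derivative √s/φ(u)³. Since s + z² =
s/φ(u)², the ball condition becomes s ≤ φ(u)². -/
lemma lintegral_line_eq {s : ℝ} (hs : 0 < s) (f : ℝ → ℝ≥0∞) :
    ∫⁻ z, {z : ℝ | s + z ^ 2 ≤ 1}.indicator (fun z => f (z / Real.sqrt (s + z ^ 2))) z =
    ∫⁻ u in Ioo (-1 : ℝ) 1, ENNReal.ofReal (1 / phi u ^ 3) *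
      ({s : ℝ | s ≤ phi u ^ 2}.indicator (fun s => ENNReal.ofReal (Real.sqrt s)) s) * f u := by
  have hss : 0 < Real.sqrt s := Real.sqrt_pos.2 hs
  have hsq : Real.sqrt s ^ 2 = s := Real.sq_sqrt hs.le
  set ψ : ℝ → ℝ := fun u => Real.sqrt s * (u / phi u) with hψ
  have hphi : ∀ u ∈ Ioo (-1 : ℝ) 1, 0 < phi u := fun u hu =>
    Real.sqrt_pos.2 (by nlinarith [hu.1, hu.2])
  have hphi2 : ∀ u ∈ Ioo (-1 : ℝ) 1, phi u ^ 2 = 1 - u ^ 2 := fun u hu =>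
    Real.sq_sqrt (by nlinarith [hu.1, hu.2])
  have hsum : ∀ u ∈ Ioo (-1 : ℝ) 1, s + ψ u ^ 2 = s / phi u ^ 2 := fun u hu => by
    have h1 := (hphi u hu).ne'
    rw [hψ]; field_simp
    rw [hphi2 u hu, hsq]; ring
  have hχψ : ∀ u ∈ Ioo (-1 : ℝ) 1, ψ u / Real.sqrt (s + ψ u ^ 2) = u := fun u hu => by
    have h1 := (hphi u hu)
    rw [hsum u hu, Real.sqrt_div hs.le, Real.sqrt_sq h1.le, hψ]
    field_simp
  have himg : ψ '' Ioo (-1) 1 = univ := by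
    refine eq_univ_of_forall fun z => ?_
    have hpos : 0 < s + z ^ 2 := by positivity
    have hlt : |z| < Real.sqrt (s + z ^ 2) := by
      apply Real.lt_sqrt_of_sq_lt; rw [sq_abs]; linarith
    have hr := Real.sqrt_pos.2 hpos
    have hrs : Real.sqrt (s + z ^ 2) ^ 2 = s + z ^ 2 := Real.sq_sqrt hpos.le
    refine ⟨z / Real.sqrt (s + z ^ 2), ?_, ?_⟩
    · rw [abs_lt] at hlt
      constructor
      · rw [lt_div_iff₀ hr]; linarith
      · rw [div_lt_iff₀ hr]; linarith
    · have : phi (z / Real.sqrt (s + z ^ 2)) = Real.sqrt s / Real.sqrt (s + z ^ 2) := by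
        rw [phi, div_pow, hrs, ← Real.sqrt_div hs.le]
        congr 1; field_simp; ring
      rw [hψ]; simp only [this]; field_simp
  have hder : ∀ u ∈ Ioo (-1 : ℝ) 1,
      HasDerivWithinAt ψ (Real.sqrt s * (1 / phi u ^ 3)) (Ioo (-1) 1) u := by
    intro u hu
    have h0 := hphi u hu
    have h1 : HasDerivAt (fun x : ℝ => 1 - x ^ 2) (-(2 * u)) u := by
      simpa using (hasDerivAt_pow 2 u).const_sub 1
    have h2 : HasDerivAt phi (-(2 * u) / (2 * phi u)) u :=
      h1.sqrt (by nlinarith [hu.1, hu.2])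
    have h3 := ((hasDerivAt_id u).div h2 h0.ne').const_mul (Real.sqrt s)
    refine (h3.congr_deriv ?_).hasDerivWithinAt
    simp only [id]
    field_simp
    linear_combination hphi2 u hu
  have hinj : InjOn ψ (Ioo (-1) 1) := fun u hu v hv huv => by
    rw [← hχψ u hu, ← hχψ v hv, huv]
  have hcv := lintegral_image_eq_lintegral_abs_deriv_mul measurableSet_Ioo hder hinj
    ({z : ℝ | s + z ^ 2 ≤ 1}.indicator (fun z => f (z / Real.sqrt (s + z ^ 2))))
  rw [himg, Measure.restrict_univ] at hcv
  rw [hcv]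
  refine setLIntegral_congr_fun measurableSet_Ioo fun u hu => ?_
  have h0 := hphi u hu
  have hiff : s + ψ u ^ 2 ≤ 1 ↔ s ≤ phi u ^ 2 := by
    rw [hsum u hu, div_le_one (by positivity)]
  simp only [indicator, mem_ofPred_eq, hiff]
  split_ifs
  · rw [hχψ u hu, abs_of_pos (by positivity), mul_comm (Real.sqrt s),
      ENNReal.ofReal_mul (by positivity)]
  · simp

/-- The integrand is homogeneous of degree 1 on the plane, hence the exponent 1 + 2. The factor a³
at a = φ(u) cancels the φ(u)^(-3) of the substitution on vertical lines, which is why the marginal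
is uniform. -/
lemma lintegral_disc_scale {a : ℝ} (ha : 0 < a) :
    ∫⁻ w : ℝ × ℝ, {s : ℝ | s ≤ a ^ 2}.indicator (fun s => ENNReal.ofReal (Real.sqrt s))
      (w.1 ^ 2 + w.2 ^ 2) = ENNReal.ofReal (a ^ 3) *
    ∫⁻ w : ℝ × ℝ, {s : ℝ | s ≤ 1}.indicator (fun s => ENNReal.ofReal (Real.sqrt s))
      (w.1 ^ 2 + w.2 ^ 2) := by
  have hm : ∀ b : ℝ, Measurable fun w : ℝ × ℝ =>
      {s : ℝ | s ≤ b}.indicator (fun s => ENNReal.ofReal (Real.sqrt s)) (w.1 ^ 2 + w.2 ^ 2) :=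
    fun b => Measurable.comp (g := {s : ℝ | s ≤ b}.indicator fun s => ENNReal.ofReal (Real.sqrt s))
      (Measurable.indicator (by fun_prop) measurableSet_Iic)
      (by fun_prop)
  have h := Measure.map_addHaar_smul (volume : Measure (ℝ × ℝ)) ha.ne'
  have h1 := lintegral_map (μ := (volume : Measure (ℝ × ℝ))) (hm (a ^ 2))
    (measurable_const_smul a)
  rw [h, lintegral_smul_measure] at h1
  have h2 : ∀ w : ℝ × ℝ, {s : ℝ | s ≤ a ^ 2}.indicator (fun s => ENNReal.ofReal (Real.sqrt s))
      ((a • w).1 ^ 2 + (a • w).2 ^ 2) = ENNReal.ofReal a *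
      {s : ℝ | s ≤ 1}.indicator (fun s => ENNReal.ofReal (Real.sqrt s)) (w.1 ^ 2 + w.2 ^ 2) := by
    intro w
    have h3 : (a • w).1 ^ 2 + (a • w).2 ^ 2 = a ^ 2 * (w.1 ^ 2 + w.2 ^ 2) := by
      simp only [Prod.smul_fst, Prod.smul_snd, smul_eq_mul]; ring
    have h4 : a ^ 2 * (w.1 ^ 2 + w.2 ^ 2) ≤ a ^ 2 ↔ w.1 ^ 2 + w.2 ^ 2 ≤ 1 := by
      rw [mul_le_iff_le_one_right (by positivity)]
    rw [h3]
    simp only [indicator, mem_ofPred_eq, h4]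
    split_ifs
    · rw [Real.sqrt_mul (by positivity), Real.sqrt_sq ha.le, ENNReal.ofReal_mul ha.le]
    · simp
  simp_rw [h2] at h1
  rw [lintegral_const_mul _ (hm 1)] at h1
  have h5 : Module.finrank ℝ (ℝ × ℝ) = 2 := by simp
  rw [h5, smul_eq_mul] at h1
  have h6 : ENNReal.ofReal (a ^ 2) * ENNReal.ofReal |(a ^ 2)⁻¹| = 1 := by
    rw [← ENNReal.ofReal_mul (by positivity), abs_of_pos (by positivity),
      mul_inv_cancel₀ (by positivity), ENNReal.ofReal_one]
  rw [pow_succ a 2, ENNReal.ofReal_mul (by positivity), mul_assoc, ← h1, ← mul_assoc, h6, one_mul]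

lemma mu_eq_restrict_Ioo : mu = volume.restrict (Ioo (-1 : ℝ) 1) :=
  (restrict_Ioo_eq_restrict_Icc).symm

lemma phi_pos {u : ℝ} (hu : u ∈ Ioo (-1 : ℝ) 1) : 0 < phi u :=
  Real.sqrt_pos.2 (by nlinarith [hu.1, hu.2])

lemma phi_nonneg (u : ℝ) : 0 ≤ phi u := Real.sqrt_nonneg _

lemma continuous_phi : Continuous phi := by unfold phi; fun_prop

lemma measurable_discIndicator : Measurable fun q : (ℝ × ℝ) × ℝ =>
    {s : ℝ | s ≤ phi q.2 ^ 2}.indicator (fun s => ENNReal.ofReal (Real.sqrt s))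
      (q.1.1 ^ 2 + q.1.2 ^ 2) := by
  have hset : MeasurableSet {q : (ℝ × ℝ) × ℝ | q.1.1 ^ 2 + q.1.2 ^ 2 ≤ phi q.2 ^ 2} :=
    measurableSet_le (by fun_prop) ((continuous_phi.comp continuous_snd).pow 2).measurable
  have h2 : Measurable ({q : (ℝ × ℝ) × ℝ | q.1.1 ^ 2 + q.1.2 ^ 2 ≤ phi q.2 ^ 2}.indicator
      fun q => ENNReal.ofReal (Real.sqrt (q.1.1 ^ 2 + q.1.2 ^ 2))) :=
    Measurable.indicator (by fun_prop) hset
  exact h2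

lemma lintegral_lintegral_disc (f : ℝ → ℝ≥0∞) (hf : Measurable f) :
    ∫⁻ w : ℝ × ℝ, ∫⁻ u in Ioo (-1 : ℝ) 1, ENNReal.ofReal (1 / phi u ^ 3) *
      ({s : ℝ | s ≤ phi u ^ 2}.indicator (fun s => ENNReal.ofReal (Real.sqrt s))
        (w.1 ^ 2 + w.2 ^ 2)) * f u =
    (∫⁻ w : ℝ × ℝ, {s : ℝ | s ≤ 1}.indicator (fun s => ENNReal.ofReal (Real.sqrt s))
      (w.1 ^ 2 + w.2 ^ 2)) * ∫⁻ u, f u ∂mu := by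
  have hphim : Measurable phi := continuous_phi.measurable
  set K : ℝ × ℝ → ℝ → ℝ≥0∞ := fun w u =>
    {s : ℝ | s ≤ phi u ^ 2}.indicator (fun s => ENNReal.ofReal (Real.sqrt s)) (w.1 ^ 2 + w.2 ^ 2)
    with hKdef
  have hKm : Measurable (fun q : (ℝ × ℝ) × ℝ => K q.1 q.2) := measurable_discIndicator
  have hK1 : ∀ u ∈ Ioo (-1 : ℝ) 1, ∫⁻ w : ℝ × ℝ, K w u = ENNReal.ofReal (phi u ^ 3) *
      ∫⁻ w : ℝ × ℝ, {s : ℝ | s ≤ 1}.indicator (fun s => ENNReal.ofReal (Real.sqrt s))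
      (w.1 ^ 2 + w.2 ^ 2) := fun u hu => lintegral_disc_scale (phi_pos hu)
  change (∫⁻ w : ℝ × ℝ, ∫⁻ u in Ioo (-1 : ℝ) 1, ENNReal.ofReal (1 / phi u ^ 3) * K w u * f u) = _
  clear_value K
  have hKu : Measurable (Function.uncurry K) := hKm
  have hKw : ∀ u, Measurable fun w => K w u := fun u => hKu.of_uncurry_right
  have hmul : Measurable fun q : (ℝ × ℝ) × ℝ =>
      ENNReal.ofReal (1 / phi q.2 ^ 3) * K q.1 q.2 * f q.2 :=
    ((by fun_prop : Measurable fun q : (ℝ × ℝ) × ℝ => ENNReal.ofReal (1 / phi q.2 ^ 3)).mul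
      hKm).mul (hf.comp measurable_snd)
  rw [lintegral_lintegral_swap (f := fun w u => ENNReal.ofReal (1 / phi u ^ 3) * K w u * f u)
    hmul.aemeasurable, mu_eq_restrict_Ioo, ← lintegral_const_mul _ hf]
  refine setLIntegral_congr_fun measurableSet_Ioo fun u hu => ?_
  have h0 := phi_pos hu
  have h1 := hK1 u hu
  rw [lintegral_mul_const _ ((hKw u).const_mul _), lintegral_const_mul _ (hKw u), h1,
    ← mul_assoc, ← ENNReal.ofReal_mul (by positivity), one_div_mul_cancel (by positivity),
    ENNReal.ofReal_one, one_mul]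

lemma exists_lintegral_ballMeasure_eq : ∃ C : ℝ≥0∞, ∀ f : ℝ → ℝ≥0∞, Measurable f →
    ∫⁻ x, f ((radialProj x).2) ∂ballMeasure = C * ∫⁻ u, f u ∂mu := by
  refine ⟨∫⁻ w : ℝ × ℝ, {s : ℝ | s ≤ 1}.indicator (fun s => ENNReal.ofReal (Real.sqrt s))
      (w.1 ^ 2 + w.2 ^ 2), fun f hf => ?_⟩
  have hmeas : Measurable fun x => f ((radialProj x).2) :=
    hf.comp (measurable_snd.comp measurable_radialProj)
  rw [ballMeasure, ← lintegral_indicator measurableSet_unitBall3, Measure.volume_eq_prod,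
    lintegral_prod _ ((hmeas.indicator measurableSet_unitBall3).aemeasurable),
    ← lintegral_lintegral_disc f hf]
  -- The substitution on a vertical line needs s > 0, so the axis w = 0 is discarded as a null set.
  have hae : ∀ᵐ w : ℝ × ℝ, 0 < w.1 ^ 2 + w.2 ^ 2 := by
    have : ∀ᵐ w : ℝ × ℝ, w ≠ 0 := by simp [ae_iff, measure_singleton]
    filter_upwards [this] with w hw
    rcases eq_or_ne w.1 0 with h1 | h1
    · rcases eq_or_ne w.2 0 with h2 | h2
      · exact absurd (Prod.ext h1 h2) hw
      · positivity
    · positivity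
  refine lintegral_congr_ae ?_
  filter_upwards [hae] with w hw
  rw [← lintegral_line_eq hw f]
  refine lintegral_congr fun z => ?_
  by_cases h : w.1 ^ 2 + w.2 ^ 2 + z ^ 2 ≤ 1
  · rw [indicator_of_mem (by exact h), indicator_of_mem (by exact h)]
    simp only [radialProj, normSq3, Prod.smul_snd, smul_eq_mul, div_eq_inv_mul]
  · rw [indicator_of_notMem (by exact h), indicator_of_notMem (by exact h)]

lemma ballMeasure_univ_pos : ballMeasure univ ≠ 0 := by
  rw [ballMeasure, Measure.restrict_apply_univ]
  have hsub : Metric.ball (0 : (ℝ × ℝ) × ℝ) (1 / 2) ⊆ {x | normSq3 x ≤ 1} := by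
    intro x hx
    rw [Metric.mem_ball, dist_zero_right, Prod.norm_def, Prod.norm_def, max_lt_iff, max_lt_iff,
      Real.norm_eq_abs, Real.norm_eq_abs, Real.norm_eq_abs, abs_lt, abs_lt, abs_lt] at hx
    simp only [normSq3, mem_ofPred_eq]
    nlinarith [hx.1.1.1, hx.1.1.2, hx.1.2.1, hx.1.2.2, hx.2.1, hx.2.2]
  exact ((Metric.measure_ball_pos volume _ (by norm_num)).trans_le (measure_mono hsub)).ne'

lemma ballMeasure_univ_lt_top : ballMeasure univ ≠ ∞ := by
  rw [ballMeasure, Measure.restrict_apply_univ]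
  have hsub : {x | normSq3 x ≤ 1} ⊆ Metric.closedBall (0 : (ℝ × ℝ) × ℝ) 1 := by
    intro x hx
    simp only [normSq3, mem_ofPred_eq] at hx
    rw [Metric.mem_closedBall, dist_zero_right, Prod.norm_def, Prod.norm_def, max_le_iff,
      max_le_iff, Real.norm_eq_abs, Real.norm_eq_abs, Real.norm_eq_abs]
    refine ⟨⟨?_, ?_⟩, ?_⟩ <;> refine abs_le_of_sq_le_sq ?_ zero_le_one <;> nlinarith
  exact ((measure_mono hsub).trans_lt (isCompact_closedBall _ _).measure_lt_top).ne

instance : IsFiniteMeasure ballMeasure := ⟨ballMeasure_univ_lt_top.lt_top⟩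

instance : IsFiniteMeasure mu := by unfold mu; infer_instance

/-- Archimedes: the projection of the sphere to an axis is a multiple of Lebesgue measure. -/
lemma exists_map_radialProj_snd : ∃ C : ℝ≥0∞, C ≠ 0 ∧ C ≠ ∞ ∧
    ballMeasure.map (fun x => (radialProj x).2) = C • mu := by
  obtain ⟨C, hC⟩ := exists_lintegral_ballMeasure_eq
  have hm : Measurable fun x => (radialProj x).2 := measurable_snd.comp measurable_radialProj
  have hmap : ballMeasure.map (fun x => (radialProj x).2) = C • mu := by
    refine Measure.ext_of_lintegral _ fun f hf => ?_
    rw [lintegral_map hf hm, hC f hf, lintegral_smul_measure, smul_eq_mul]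
  have huniv : ballMeasure univ = C * 2 := by
    have := congrArg (fun ν : Measure ℝ => ν univ) hmap
    simp only [Measure.map_apply hm MeasurableSet.univ, preimage_univ, Measure.smul_apply,
      smul_eq_mul, mu, Measure.restrict_apply_univ, Real.volume_Icc] at this
    rw [this]; norm_num
  refine ⟨C, ?_, ?_, hmap⟩
  · rintro rfl; exact ballMeasure_univ_pos (by rw [huniv, zero_mul])
  · rintro rfl; exact ballMeasure_univ_lt_top (by simp [huniv])

/-! ### A ladder operator on the sphere and Bernstein's inequality -/

open Polynomial

/-- The function `(x + i y) ^ m Q(z)` on `(ℝ × ℝ) × ℝ`. -/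
noncomputable def sphereFun (m : ℕ) (Q : ℝ[X]) (x : (ℝ × ℝ) × ℝ) : ℂ :=
  ((x.1.1 : ℂ) + x.1.2 * Complex.I) ^ m * (Q.eval x.2 : ℝ)

lemma continuous_sphereFun (m : ℕ) (Q : ℝ[X]) : Continuous (sphereFun m Q) := by
  unfold sphereFun
  have := Q.continuous
  fun_prop

lemma ofReal_eval (Q : ℝ[X]) (y : ℝ) :
    ((Q.eval y : ℝ) : ℂ) = (Q.map Complex.ofRealHom).eval (y : ℂ) := by
  rw [eval_map]
  exact (eval₂_at_apply Complex.ofRealHom y).symm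

lemma isTrigPoly_ofReal_eval {n : ℕ} {Q : ℝ[X]} (hQ : Q.natDegree ≤ n) (a b : ℝ) :
    IsTrigPoly n (fun t => ((Q.eval (a * Real.sin t + b * Real.cos t) : ℝ) : ℂ)) := by
  have h := (IsTrigPoly.cos_sin (b : ℂ) (a : ℂ)).polynomial_eval (Q.map Complex.ofRealHom) (n := n)
    (natDegree_map_le.trans hQ)
  convert! h using 2 with t
  rw [ofReal_eval]
  congr 1
  push_cast
  ring

lemma isTrigPoly_sphereFun_rotA {m n : ℕ} {Q : ℝ[X]} (hQ : m + Q.natDegree ≤ n)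
    (x : (ℝ × ℝ) × ℝ) : IsTrigPoly n (fun t => sphereFun m Q (rotA t x)) := by
  have h1 := ((IsTrigPoly.const (x.1.1 : ℂ)).mono (Nat.zero_le 1)).add
    (IsTrigPoly.cos_sin (x.1.2 * Complex.I) (-(x.2 * Complex.I)))
  have h2 := ((h1.pow m).mul (isTrigPoly_ofReal_eval le_rfl x.1.2 x.2)).mono
    (by omega : m * 1 + Q.natDegree ≤ n)
  convert! h2 using 2 with t
  simp only [sphereFun, rotA]
  congr 2
  push_cast
  ring

lemma isTrigPoly_sphereFun_rotB {m n : ℕ} {Q : ℝ[X]} (hQ : m + Q.natDegree ≤ n)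
    (x : (ℝ × ℝ) × ℝ) : IsTrigPoly n (fun t => sphereFun m Q (rotB t x)) := by
  have h1 := ((IsTrigPoly.const (x.1.2 * Complex.I)).mono (Nat.zero_le 1)).add
    (IsTrigPoly.cos_sin (x.1.1 : ℂ) (-x.2 : ℂ))
  have h2 := ((h1.pow m).mul (isTrigPoly_ofReal_eval le_rfl x.1.1 x.2)).mono
    (by omega : m * 1 + Q.natDegree ≤ n)
  convert! h2 using 2 with t
  simp only [sphereFun, rotB]
  congr 2
  push_cast
  ring

lemma hasDerivAt_sphereFun_rotA (m : ℕ) (Q : ℝ[X]) (x : (ℝ × ℝ) × ℝ) :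
    HasDerivAt (fun t => sphereFun m Q (rotA t x))
      (m * ((x.1.1 : ℂ) + x.1.2 * Complex.I) ^ (m - 1) * (-(x.2 * Complex.I)) * (Q.eval x.2 : ℝ) +
        ((x.1.1 : ℂ) + x.1.2 * Complex.I) ^ m * (Q.derivative.eval x.2 * x.1.2 : ℝ)) 0 := by
  have hy : HasDerivAt (fun t => x.1.2 * Real.cos t - x.2 * Real.sin t) (-x.2) 0 := by
    simpa using ((Real.hasDerivAt_cos 0).const_mul x.1.2).fun_sub
      ((Real.hasDerivAt_sin 0).const_mul x.2)
  have hz : HasDerivAt (fun t => x.1.2 * Real.sin t + x.2 * Real.cos t) x.1.2 0 := by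
    simpa using ((Real.hasDerivAt_sin 0).const_mul x.1.2).fun_add
      ((Real.hasDerivAt_cos 0).const_mul x.2)
  have h1 := (((hy.ofReal_comp).mul_const Complex.I).const_add (x.1.1 : ℂ)).pow m
  have h2 : HasDerivAt (fun t => Q.eval (x.1.2 * Real.sin t + x.2 * Real.cos t))
      (Q.derivative.eval x.2 * x.1.2) 0 := by
    have := (Q.hasDerivAt (x.1.2 * Real.sin 0 + x.2 * Real.cos 0)).comp (0 : ℝ) hz
    simpa [Function.comp_def] using this
  refine (h1.mul h2.ofReal_comp).congr_deriv ?_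
  simp

lemma hasDerivAt_sphereFun_rotB (m : ℕ) (Q : ℝ[X]) (x : (ℝ × ℝ) × ℝ) :
    HasDerivAt (fun t => sphereFun m Q (rotB t x))
      (m * ((x.1.1 : ℂ) + x.1.2 * Complex.I) ^ (m - 1) * (-x.2) * (Q.eval x.2 : ℝ) +
        ((x.1.1 : ℂ) + x.1.2 * Complex.I) ^ m * (Q.derivative.eval x.2 * x.1.1 : ℝ)) 0 := by
  have hy : HasDerivAt (fun t => x.1.1 * Real.cos t - x.2 * Real.sin t) (-x.2) 0 := by
    simpa using ((Real.hasDerivAt_cos 0).const_mul x.1.1).fun_sub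
      ((Real.hasDerivAt_sin 0).const_mul x.2)
  have hz : HasDerivAt (fun t => x.1.1 * Real.sin t + x.2 * Real.cos t) x.1.1 0 := by
    simpa using ((Real.hasDerivAt_sin 0).const_mul x.1.1).fun_add
      ((Real.hasDerivAt_cos 0).const_mul x.2)
  have h1 := ((hy.ofReal_comp).add_const (x.1.2 * Complex.I)).pow m
  have h2 : HasDerivAt (fun t => Q.eval (x.1.1 * Real.sin t + x.2 * Real.cos t))
      (Q.derivative.eval x.2 * x.1.1) 0 := by
    have := (Q.hasDerivAt (x.1.1 * Real.sin 0 + x.2 * Real.cos 0)).comp (0 : ℝ) hz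
    simpa [Function.comp_def] using this
  refine (h1.mul h2.ofReal_comp).congr_deriv ?_
  simp

/-- In the combination B + iA of the two rotational derivatives the terms containing Q cancel
because i² = -1, and the terms containing Q' combine to the factor x + iy. The interpolation formula
then replaces both derivatives by rotated values, with nodes that depend on n only. -/
lemma exists_sphereFun_succ_eq (n : ℕ) : ∃ (s : Finset ℕ) (t : ℕ → ℝ) (c : ℕ → ℂ),
    ∑ k ∈ s, ‖c k‖ ≤ 3 * n ∧ ∀ (m : ℕ) (Q : ℝ[X]), m + Q.natDegree ≤ n → ∀ x,
    sphereFun (m + 1) Q.derivative x = ∑ k ∈ s, c k * sphereFun m Q (rotB (t k) x) +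
      ∑ k ∈ s, Complex.I * c k * sphereFun m Q (rotA (t k) x) := by
  obtain ⟨s, t, c, hc, h⟩ := exists_deriv_trigPoly_eq n
  refine ⟨s, t, c, hc, fun m Q hQ x => ?_⟩
  have hB := (h _ (isTrigPoly_sphereFun_rotB hQ x)).unique (hasDerivAt_sphereFun_rotB m Q x)
  have hA := (h _ (isTrigPoly_sphereFun_rotA hQ x)).unique (hasDerivAt_sphereFun_rotA m Q x)
  simp_rw [mul_assoc Complex.I]
  rw [← Finset.mul_sum, hA, hB]
  simp only [sphereFun]
  push_cast
  linear_combination (↑m * ((x.1.1 : ℂ) + x.1.2 * Complex.I) ^ (m - 1) * x.2 * (Q.eval x.2 : ℝ)) *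
    Complex.I_sq

/-- Rotations commute with the radial projection and preserve the measure of the ball, so every
rotated copy has the same norm. Each of the two families has total weight at most 3n. -/
lemma eLpNorm_sphereFun_succ_le {p : ℝ≥0∞} (hp : 1 ≤ p) {m n : ℕ} {Q : ℝ[X]}
    (hQ : m + Q.natDegree ≤ n) :
    eLpNorm (sphereFun (m + 1) Q.derivative ∘ radialProj) p ballMeasure ≤
      6 * n * eLpNorm (sphereFun m Q ∘ radialProj) p ballMeasure := by
  obtain ⟨s, t, c, hc, h⟩ := exists_sphereFun_succ_eq n
  set F := sphereFun m Q ∘ radialProj with hF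
  have hFm : AEStronglyMeasurable F ballMeasure :=
    ((continuous_sphereFun m Q).measurable.comp measurable_radialProj).aestronglyMeasurable
  have hA : ∀ u, AEStronglyMeasurable (F ∘ rotA u) ballMeasure ∧
      eLpNorm (F ∘ rotA u) p ballMeasure = eLpNorm F p ballMeasure := fun u =>
    ⟨hFm.comp_measurePreserving (measurePreserving_ballMeasure_rotA u),
      eLpNorm_comp_measurePreserving hFm (measurePreserving_ballMeasure_rotA u)⟩
  have hB : ∀ u, AEStronglyMeasurable (F ∘ rotB u) ballMeasure ∧
      eLpNorm (F ∘ rotB u) p ballMeasure = eLpNorm F p ballMeasure := fun u =>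
    ⟨hFm.comp_measurePreserving (measurePreserving_ballMeasure_rotB u),
      eLpNorm_comp_measurePreserving hFm (measurePreserving_ballMeasure_rotB u)⟩
  have heq : sphereFun (m + 1) Q.derivative ∘ radialProj =
      (∑ k ∈ s, c k • (F ∘ rotB (t k))) + ∑ k ∈ s, (Complex.I * c k) • (F ∘ rotA (t k)) := by
    funext x
    simp only [Function.comp_apply, h m Q hQ, hF, Pi.add_apply, Finset.sum_apply, Pi.smul_apply,
      smul_eq_mul, radialProj_rotA, radialProj_rotB]
  have hsum : ∑ k ∈ s, ‖c k‖ₑ ≤ 3 * n := by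
    have : ∑ k ∈ s, ‖c k‖ₑ = ENNReal.ofReal (∑ k ∈ s, ‖c k‖) := by
      rw [ENNReal.ofReal_sum_of_nonneg fun _ _ => norm_nonneg _]
      simp_rw [ofReal_norm]
    rw [this]
    refine (ENNReal.ofReal_le_ofReal hc).trans_eq ?_
    rw [ENNReal.ofReal_mul (by norm_num), ENNReal.ofReal_natCast]
    norm_num
  have hmB : ∀ k ∈ s, AEStronglyMeasurable (c k • (F ∘ rotB (t k))) ballMeasure :=
    fun k _ => (hB _).1.const_smul _
  have hmA : ∀ k ∈ s, AEStronglyMeasurable ((Complex.I * c k) • (F ∘ rotA (t k))) ballMeasure :=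
    fun k _ => (hA _).1.const_smul _
  rw [heq]
  calc _ ≤ eLpNorm (∑ k ∈ s, c k • (F ∘ rotB (t k))) p ballMeasure +
        eLpNorm (∑ k ∈ s, (Complex.I * c k) • (F ∘ rotA (t k))) p ballMeasure :=
        eLpNorm_add_le (Finset.aestronglyMeasurable_sum _ hmB)
          (Finset.aestronglyMeasurable_sum _ hmA) hp
    _ ≤ ∑ k ∈ s, ‖c k‖ₑ * eLpNorm F p ballMeasure +
        ∑ k ∈ s, ‖c k‖ₑ * eLpNorm F p ballMeasure := by
        refine add_le_add ((eLpNorm_sum_le hmB hp).trans_eq ?_)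
          ((eLpNorm_sum_le hmA hp).trans_eq ?_)
        · refine Finset.sum_congr rfl fun k _ => ?_
          rw [eLpNorm_const_smul, (hB _).2]
        · refine Finset.sum_congr rfl fun k _ => ?_
          rw [eLpNorm_const_smul, (hA _).2, enorm_mul]
          simp [enorm_eq_nnnorm]
    _ ≤ 3 * n * eLpNorm F p ballMeasure + 3 * n * eLpNorm F p ballMeasure := by
        rw [← Finset.sum_mul]
        gcongr
    _ = 6 * n * eLpNorm F p ballMeasure := by ring

lemma norm_sphereFun_radialProj (m : ℕ) (Q : ℝ[X]) {x : (ℝ × ℝ) × ℝ} (hx : x ≠ 0) :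
    ‖sphereFun m Q (radialProj x)‖ =
      ‖Q.eval (radialProj x).2 * phi (radialProj x).2 ^ m‖ := by
  have hpos : 0 < normSq3 x := by
    rcases (normSq3_nonneg x).lt_or_eq with h | h
    · exact h
    · refine absurd ?_ hx
      simp only [normSq3] at h
      have h1 : x.1.1 = 0 := by nlinarith [sq_nonneg x.1.1, sq_nonneg x.1.2, sq_nonneg x.2]
      have h2 : x.1.2 = 0 := by nlinarith [sq_nonneg x.1.1, sq_nonneg x.1.2, sq_nonneg x.2]
      have h3 : x.2 = 0 := by nlinarith [sq_nonneg x.1.1, sq_nonneg x.1.2, sq_nonneg x.2]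
      exact Prod.ext (Prod.ext h1 h2) h3
  have hsq := Real.sq_sqrt hpos.le
  have hs := Real.sqrt_pos.2 hpos
  set y := radialProj x with hy
  have h1 : y.1.1 ^ 2 + y.1.2 ^ 2 + y.2 ^ 2 = 1 := by
    simp only [hy, radialProj, Prod.smul_fst, Prod.smul_snd, smul_eq_mul]
    field_simp
    rw [hsq]; rfl
  have h2 : ‖(y.1.1 : ℂ) + y.1.2 * Complex.I‖ = phi y.2 := by
    rw [Complex.norm_add_mul_I, phi]
    congr 1
    linarith
  rw [sphereFun, norm_mul, norm_mul, norm_pow, norm_pow, h2, Complex.norm_real,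
    Real.norm_of_nonneg (phi_nonneg _), mul_comm]

/-- On the sphere |x+iy| = φ(z), and the law of z is a multiple C of Lebesgue measure, so K =
C^(1/p). That K is neither 0 nor ∞ lets it cancel from Bernstein's inequality. -/
lemma exists_eLpNorm_sphereFun_eq (p : ℝ≥0∞) : ∃ K : ℝ≥0∞, K ≠ 0 ∧ K ≠ ∞ ∧
    ∀ (m : ℕ) (Q : ℝ[X]), eLpNorm (sphereFun m Q ∘ radialProj) p ballMeasure =
      K * eLpNorm (fun u => Q.eval u * phi u ^ m) p mu := by
  obtain ⟨C, hC0, hCt, hC⟩ := exists_map_radialProj_snd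
  have hexp : 0 ≤ (1 / p).toReal := ENNReal.toReal_nonneg
  refine ⟨C ^ (1 / p).toReal, (ENNReal.rpow_pos hC0.bot_lt hCt).ne',
    ENNReal.rpow_ne_top_of_nonneg hexp hCt, fun m Q => ?_⟩
  have hm : Measurable fun x => (radialProj x).2 := measurable_snd.comp measurable_radialProj
  rw [← smul_eq_mul, ← eLpNorm_smul_measure_of_ne_zero hC0, ← hC,
    eLpNorm_map_measure (by have := Q.continuous; have := continuous_phi; fun_prop) hm.aemeasurable]
  refine eLpNorm_congr_norm_ae ?_
  have h0 : ∀ᵐ x ∂ballMeasure, x ≠ 0 := by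
    refine ae_restrict_of_ae ?_
    have h : volume ({0} : Set ((ℝ × ℝ) × ℝ)) = 0 := by
      rw [Measure.volume_eq_prod]
      exact measure_singleton _
    simpa [ae_iff] using h
  filter_upwards [h0] with x hx
  exact norm_sphereFun_radialProj m Q hx

/-- Bernstein's inequality for algebraic polynomials in `L_p[-1, 1]`, with the weights `φ ^ m`. -/
theorem eLpNorm_iterate_derivative_mul_phi_pow_le {p : ℝ≥0∞} (hp : 1 ≤ p) {n : ℕ} {Q : ℝ[X]}
    (hQ : Q.natDegree ≤ n) (m : ℕ) :
    eLpNorm (fun u => (derivative^[m] Q).eval u * phi u ^ m) p mu ≤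
      (6 * n) ^ m * eLpNorm (fun u => Q.eval u) p mu := by
  rcases lt_or_ge n m with hmn | hmn
  · rw [iterate_derivative_eq_zero (by omega)]
    simp
  obtain ⟨K, hK0, hKt, hK⟩ := exists_eLpNorm_sphereFun_eq p
  have key : ∀ m ≤ n, eLpNorm (sphereFun m (derivative^[m] Q) ∘ radialProj) p ballMeasure ≤
      (6 * n) ^ m * eLpNorm (sphereFun 0 Q ∘ radialProj) p ballMeasure := by
    intro m hm
    induction m with
    | zero => simp
    | succ m ih =>
      -- Each step raises the power of x + iy by one and lowers the degree of the polynomial, so the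
      -- total degree stays at most n and the factor 6n does not change.
      have hd : m + (derivative^[m] Q).natDegree ≤ n := by
        have := natDegree_iterate_derivative Q m
        omega
      rw [Function.iterate_succ_apply']
      refine (eLpNorm_sphereFun_succ_le hp hd).trans ?_
      rw [pow_succ', mul_assoc (6 * (n : ℝ≥0∞))]
      gcongr
      exact ih (by omega)
  have h := key m hmn
  rw [hK, hK, mul_left_comm, ENNReal.mul_le_mul_iff_right hK0 hKt] at h
  simpa using h

/-! ### The steps x ↦ x + cφ(x) and weighted differences of functions -/

/-- The weighted difference whose `L_p` norm enters the modulus of smoothness. -/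
noncomputable def weightedDiff (k r : ℕ) (h : ℝ) (g : ℝ → ℝ) (x : ℝ) : ℝ :=
  weight (k * h) x ^ r * symmDifference k (h * phi x) g x (Icc (-1) 1)

/-- The points `x` of `(-1, 1)` for which `x ± a φ(x)` lie in `[-1, 1]`. -/
def stepDomain (a : ℝ) : Set ℝ := {x ∈ Ioo (-1 : ℝ) 1 | a * phi x ≤ 1 - |x|}

lemma measurableSet_stepDomain (a : ℝ) : MeasurableSet (stepDomain a) := by
  have := continuous_phi
  have h1 : Measurable fun x => a * phi x := by fun_prop
  have h2 : Measurable fun x : ℝ => 1 - |x| := by fun_prop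
  exact measurableSet_Ioo.inter (measurableSet_le h1 h2)

lemma phi_sq {x : ℝ} (hx : x ∈ Ioo (-1 : ℝ) 1) : phi x ^ 2 = (1 - |x|) * (1 + |x|) := by
  rw [phi, Real.sq_sqrt (by nlinarith [hx.1, hx.2])]
  nlinarith [sq_abs x]

lemma abs_add_step_le {a c x : ℝ} (hc : |c| ≤ a) (hx : x ∈ stepDomain a) :
    |x + c * phi x| ≤ 1 := by
  have h1 : |c * phi x| ≤ a * phi x := by
    rw [abs_mul, abs_of_nonneg (phi_nonneg x)]
    exact mul_le_mul_of_nonneg_right hc (phi_nonneg x)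
  have := abs_add_le x (c * phi x)
  linarith [hx.2]

/-- Dividing aφ ≤ 1 - |x| into φ² = (1-|x|)(1+|x|) gives a(1+|x|) ≤ φ, and 2|x| ≤ 1 + |x|. As φ' =
-x/φ, this says that cφ' is at most 1/2 in modulus for |c| ≤ a. -/
lemma step_mul_abs_le {a x : ℝ} (hx : x ∈ stepDomain a) : a * |x| ≤ phi x / 2 := by
  have h0 := phi_pos hx.1
  have h1 := phi_sq hx.1
  have h2 := hx.2
  have h3 : 0 ≤ |x| := abs_nonneg x
  have h4 : |x| < 1 := abs_lt.2 hx.1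
  have h5 : a * (1 + |x|) ≤ phi x := by
    have : (a * (1 + |x|)) * phi x ≤ phi x * phi x := by nlinarith
    exact le_of_mul_le_mul_right this h0
  nlinarith

/-- Two distinct points with the same image satisfy φ(x) + φ(y) = c(x+y), while the right side is at
most half of the left one. This algebraic argument avoids discussing the shape of the domain. -/
lemma injOn_step {a c : ℝ} (hc : |c| ≤ a) : InjOn (fun x => x + c * phi x) (stepDomain a) := by
  intro x hx y hy hxy
  by_contra hne
  have hx0 := phi_pos hx.1
  have hy0 := phi_pos hy.1
  have hx2 : phi x ^ 2 = 1 - x ^ 2 := by rw [phi_sq hx.1]; nlinarith [sq_abs x]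
  have hy2 : phi y ^ 2 = 1 - y ^ 2 := by rw [phi_sq hy.1]; nlinarith [sq_abs y]
  have hxy' : x + c * phi x = y + c * phi y := hxy
  have h1 : (x - y) * (phi x + phi y - c * (x + y)) = 0 := by
    linear_combination (phi x + phi y) * hxy' - c * (hx2 - hy2)
  have h2 : phi x + phi y = c * (x + y) := by
    rcases mul_eq_zero.1 h1 with h | h
    · exact absurd (sub_eq_zero.1 h) hne
    · linarith
  have h3 : ∀ z, c * z ≤ a * |z| := fun z =>
    (le_abs_self _).trans (by rw [abs_mul]; exact mul_le_mul_of_nonneg_right hc (abs_nonneg z))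
  have := h3 x
  have := h3 y
  have := step_mul_abs_le hx
  have := step_mul_abs_le hy
  linarith

/-- Change of variables: the step is injective with derivative at least 1/2, and its values stay in
[-1,1]. -/
lemma map_step_le {a c : ℝ} (hc : |c| ≤ a) :
    (volume.restrict (stepDomain a)).map (fun x => x + c * phi x) ≤ (2 : ℝ≥0∞) • mu := by
  have hT : Measurable fun x => x + c * phi x := by
    have := continuous_phi
    fun_prop
  have hD := measurableSet_stepDomain a
  refine Measure.le_iff.2 fun s hs => ?_
  have hder : ∀ x ∈ stepDomain a, HasDerivWithinAt (fun x => x + c * phi x)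
      (1 + c * (-x / phi x)) (stepDomain a) x := by
    intro x hx
    have h0 := phi_pos hx.1
    have h1 : HasDerivAt (fun x : ℝ => 1 - x ^ 2) (-(2 * x)) x := by
      simpa using (hasDerivAt_pow 2 x).const_sub 1
    have h2 : HasDerivAt phi (-(2 * x) / (2 * phi x)) x :=
      h1.sqrt (by nlinarith [hx.1.1, hx.1.2])
    refine (((hasDerivAt_id x).add (h2.const_mul c)).congr_deriv ?_).hasDerivWithinAt
    field_simp
  have hcv := lintegral_image_eq_lintegral_abs_deriv_mul hD hder (injOn_step hc) (s.indicator 1)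
  have hlow : ∀ x ∈ stepDomain a, 1 / 2 ≤ |1 + c * (-x / phi x)| := by
    intro x hx
    have h0 := phi_pos hx.1
    have h1 : |c * (-x / phi x)| ≤ 1 / 2 := by
      rw [abs_mul, abs_div, abs_neg, abs_of_pos h0, ← mul_div_assoc, div_le_iff₀ h0]
      have := mul_le_mul_of_nonneg_right hc (abs_nonneg x)
      linarith [step_mul_abs_le hx]
    have := neg_abs_le (c * (-x / phi x))
    exact le_trans (by linarith) (le_abs_self _)
  rw [Measure.map_apply hT hs, Measure.smul_apply, smul_eq_mul]
  calc (volume.restrict (stepDomain a)) ((fun x => x + c * phi x) ⁻¹' s)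
      = ∫⁻ x in stepDomain a, s.indicator 1 (x + c * phi x) := by
        rw [← lintegral_indicator_one (hT hs)]
        rfl
    _ ≤ ∫⁻ x in stepDomain a, 2 * (ENNReal.ofReal |1 + c * (-x / phi x)| *
          s.indicator 1 (x + c * phi x)) := by
        refine setLIntegral_mono' hD fun x hx => ?_
        rw [← mul_assoc]
        refine le_mul_of_one_le_left zero_le ?_
        have : (2 : ℝ≥0∞) = ENNReal.ofReal 2 := by norm_num
        rw [this, ← ENNReal.ofReal_mul (by norm_num), ← ENNReal.ofReal_one]
        exact ENNReal.ofReal_le_ofReal (by linarith [hlow x hx])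
    _ = 2 * ∫⁻ x in (fun x => x + c * phi x) '' stepDomain a, s.indicator 1 x := by
        rw [hcv, lintegral_const_mul' _ _ (by norm_num)]
    _ ≤ 2 * mu s := by
        gcongr
        rw [← lintegral_indicator_one hs, mu]
        refine lintegral_mono_set ?_
        rintro _ ⟨x, hx, rfl⟩
        exact abs_le.1 (abs_add_step_le hc hx)

lemma restrict_mu_stepDomain (a : ℝ) :
    mu.restrict (stepDomain a) = volume.restrict (stepDomain a) := by
  rw [mu, Measure.restrict_restrict (measurableSet_stepDomain a)]
  congr 1
  exact inter_eq_left.2 fun x hx => Ioo_subset_Icc_self hx.1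

lemma eLpNorm_indicator_comp_step_le {p : ℝ≥0∞} (hp : 1 ≤ p) {a c : ℝ} (hc : |c| ≤ a)
    {v : ℝ → ℝ} (hv : Measurable v) :
    eLpNorm ((stepDomain a).indicator fun x => v (x + c * phi x)) p mu ≤
      2 * eLpNorm v p mu := by
  have hT : Measurable fun x => x + c * phi x := by
    have := continuous_phi
    fun_prop
  rw [eLpNorm_indicator_eq_eLpNorm_restrict (measurableSet_stepDomain a), restrict_mu_stepDomain]
  have h1 := eLpNorm_map_measure (μ := volume.restrict (stepDomain a)) (p := p)
    hv.aestronglyMeasurable hT.aemeasurable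
  change eLpNorm (v ∘ fun x => x + c * phi x) p _ ≤ _
  rw [← h1]
  refine (eLpNorm_mono_measure v (map_step_le hc)).trans ((eLpNorm_smul_measure_le _ _ _ _).trans ?_)
  rw [smul_eq_mul]
  gcongr
  have h2 : (1 / p).toReal ≤ 1 := by
    have : 1 / p ≤ 1 := by rw [one_div]; exact ENNReal.inv_le_one.2 hp
    simpa using ENNReal.toReal_mono ENNReal.one_ne_top this
  exact (ENNReal.rpow_le_rpow_of_exponent_le (by norm_num) h2).trans_eq (ENNReal.rpow_one 2)

lemma mem_Icc_iff_mem_stepDomain {k : ℕ} {h x : ℝ} (hx : x ∈ Ioo (-1 : ℝ) 1) (hh : 0 ≤ h) :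
    (x + k * (h * phi x) / 2 ∈ Icc (-1 : ℝ) 1 ∧ x - k * (h * phi x) / 2 ∈ Icc (-1 : ℝ) 1) ↔
      x ∈ stepDomain (k * h / 2) := by
  have h0 : 0 ≤ k * (h * phi x) := by have := phi_nonneg x; positivity
  simp only [stepDomain, mem_Icc, mem_ofPred_eq, hx, true_and]
  constructor
  · rintro ⟨⟨h1, h2⟩, h3, h4⟩
    rcases abs_cases x with ⟨h, _⟩ | ⟨h, _⟩ <;> rw [h] <;> linarith
  · intro h5
    have := le_abs_self x
    have := neg_abs_le x
    refine ⟨⟨?_, ?_⟩, ?_, ?_⟩ <;> linarith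

/-- On the domain both factors of the weight are nonnegative, and each is the worst case of 1 ∓ y
over the admissible shifts y = x + cφ(x). -/
lemma weight_le_phi_step {k : ℕ} {h c x : ℝ} (hc : |c| ≤ k * h / 2)
    (hx : x ∈ stepDomain (k * h / 2)) : weight (k * h) x ≤ phi (x + c * phi x) := by
  have h0 := phi_nonneg x
  have h1 : |c * phi x| ≤ k * h / 2 * phi x := by
    rw [abs_mul, abs_of_nonneg h0]
    exact mul_le_mul_of_nonneg_right hc h0
  rw [abs_le] at h1
  have h2 := hx.2
  have := le_abs_self x
  have := neg_abs_le x
  refine Real.sqrt_le_sqrt ?_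
  have h3 : (1 - x - k * h * phi x / 2) * (1 + x - k * h * phi x / 2) ≤
      (1 - (x + c * phi x)) * (1 + (x + c * phi x)) :=
    mul_le_mul (by linarith) (by linarith) (by linarith) (by linarith)
  linarith

lemma measurable_weight (δ : ℝ) : Measurable (weight δ) := by
  have := continuous_phi
  unfold weight
  fun_prop

lemma measurable_weightedDiff (k r : ℕ) (h : ℝ) {g : ℝ → ℝ} (hg : Measurable g) :
    Measurable (weightedDiff k r h g) := by
  have := continuous_phi.measurable
  unfold weightedDiff symmDifference
  refine ((measurable_weight _).pow_const r).mul (Measurable.ite ?_ ?_ measurable_const)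
  · have h1 : Measurable fun x => x + k * (h * phi x) / 2 := by fun_prop
    have h2 : Measurable fun x => x - k * (h * phi x) / 2 := by fun_prop
    exact (h1 measurableSet_Icc).inter (h2 measurableSet_Icc)
  · refine Finset.measurable_fun_sum _ fun i _ => ?_
    refine Measurable.const_mul (hg.comp ?_) _
    fun_prop

lemma weightedDiff_add (k r : ℕ) (h : ℝ) (f g : ℝ → ℝ) :
    weightedDiff k r h (fun x => f x + g x) =
      weightedDiff k r h f + weightedDiff k r h g := by
  funext x
  simp only [weightedDiff, symmDifference, Pi.add_apply]
  split_ifs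
  · simp only [mul_add, Finset.sum_add_distrib]
  · simp

lemma eLpNorm_weightedDiff_add_le {p : ℝ≥0∞} (hp : 1 ≤ p) (k r : ℕ) (h : ℝ) {f g : ℝ → ℝ}
    (hf : Measurable f) (hg : Measurable g) :
    eLpNorm (weightedDiff k r h (fun x => f x + g x)) p mu ≤
      eLpNorm (weightedDiff k r h f) p mu + eLpNorm (weightedDiff k r h g) p mu := by
  rw [weightedDiff_add]
  exact eLpNorm_add_le (measurable_weightedDiff k r h hf).aestronglyMeasurable
    (measurable_weightedDiff k r h hg).aestronglyMeasurable hp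

lemma ae_mu_mem_Ioo : ∀ᵐ x ∂mu, x ∈ Ioo (-1 : ℝ) 1 := by
  rw [mu_eq_restrict_Ioo]
  exact ae_restrict_mem measurableSet_Ioo

/-- The weighted difference is bounded by the weighted norm of the function. -/
lemma eLpNorm_weightedDiff_le {p : ℝ≥0∞} (hp : 1 ≤ p) (k r : ℕ) {h : ℝ} (hh : 0 ≤ h) {g : ℝ → ℝ}
    (hg : Measurable g) :
    eLpNorm (weightedDiff k r h g) p mu ≤
      2 ^ (k + 1) * eLpNorm (fun x => g x * phi x ^ r) p mu := by
  set v : ℝ → ℝ := fun x => g x * phi x ^ r with hv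
  have hphi := continuous_phi.measurable
  have hvm : Measurable v := hg.mul (hphi.pow_const r)
  set a : ℝ := k * h / 2 with ha
  set c : ℕ → ℝ := fun i => ((i : ℝ) - (k : ℝ) / 2) * h with hcdef
  have hc : ∀ i ∈ Finset.range (k + 1), |c i| ≤ a := by
    intro i hi
    have hi' : (i : ℝ) ≤ k := by exact_mod_cast Finset.mem_range_succ_iff.1 hi
    have hi0 : (0 : ℝ) ≤ i := Nat.cast_nonneg i
    rw [hcdef, ha, abs_mul, abs_of_nonneg hh]
    have : |(i : ℝ) - k / 2| ≤ k / 2 := abs_le.2 ⟨by linarith, by linarith⟩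
    calc _ ≤ (k : ℝ) / 2 * h := mul_le_mul_of_nonneg_right this hh
      _ = _ := by ring
  -- One majorant per node of the difference: the binomial coefficients sum to 2^k, and the change
  -- of variables costs another factor 2.
  set F : ℕ → ℝ → ℝ := fun i => (k.choose i : ℝ) •
    (stepDomain a).indicator fun x => |v (x + c i * phi x)| with hF
  have hFm : ∀ i ∈ Finset.range (k + 1), AEStronglyMeasurable (F i) mu := by
    intro i _
    have h1 : Measurable fun x => |v (x + c i * phi x)| :=
      (hvm.comp (by fun_prop : Measurable fun x => x + c i * phi x)).abs
    exact ((h1.indicator (measurableSet_stepDomain a)).const_smul _).aestronglyMeasurable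
  have hFn : ∀ i ∈ Finset.range (k + 1), eLpNorm (F i) p mu ≤
      (k.choose i : ℝ≥0∞) * (2 * eLpNorm v p mu) := by
    intro i hi
    rw [hF, eLpNorm_const_smul]
    have h1 := eLpNorm_indicator_comp_step_le hp (hc i hi) (v := fun x => |v x|) hvm.abs
    have h2 : eLpNorm (fun x => |v x|) p mu = eLpNorm v p mu :=
      eLpNorm_congr_norm_ae (Filter.Eventually.of_forall fun x => by simp)
    rw [h2] at h1
    refine mul_le_mul' ?_ h1
    rw [Real.enorm_natCast]
  have hpt : ∀ᵐ x ∂mu, ‖weightedDiff k r h g x‖ ≤ (∑ i ∈ Finset.range (k + 1), F i) x := by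
    filter_upwards [ae_mu_mem_Ioo] with x hx
    rw [weightedDiff, symmDifference, Finset.sum_apply]
    by_cases hxD : x ∈ stepDomain a
    · rw [if_pos ((mem_Icc_iff_mem_stepDomain hx hh).2 hxD), Finset.mul_sum]
      refine (norm_sum_le _ _).trans (Finset.sum_le_sum fun i hi => ?_)
      simp only [hF, Pi.smul_apply, smul_eq_mul, indicator_of_mem hxD]
      have hstep : x + ((i : ℝ) - k / 2) * (h * phi x) = x + c i * phi x := by
        rw [hcdef]; ring
      rw [hstep, norm_mul, norm_mul, norm_mul, norm_pow, norm_pow, norm_neg, norm_one, one_pow,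
        mul_one, Real.norm_natCast, mul_left_comm]
      refine mul_le_mul_of_nonneg_left ?_ (Nat.cast_nonneg _)
      rw [hv, abs_mul, mul_comm, Real.norm_eq_abs]
      refine mul_le_mul_of_nonneg_left ?_ (abs_nonneg _)
      have hw : 0 ≤ weight (k * h) x := Real.sqrt_nonneg _
      rw [Real.norm_eq_abs, abs_of_nonneg hw, abs_of_nonneg (pow_nonneg (phi_nonneg _) r)]
      exact pow_le_pow_left₀ (Real.sqrt_nonneg _) (weight_le_phi_step (hc i hi) hxD) r
    · rw [if_neg (fun hcon => hxD ((mem_Icc_iff_mem_stepDomain hx hh).1 hcon)), mul_zero, norm_zero]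
      refine Finset.sum_nonneg fun i _ => ?_
      simp only [hF, Pi.smul_apply, smul_eq_mul, indicator_of_notMem hxD, mul_zero, le_refl]
  refine (eLpNorm_mono_ae_real hpt).trans ((eLpNorm_sum_le hFm hp).trans
    ((Finset.sum_le_sum hFn).trans_eq ?_))
  rw [← Finset.sum_mul, ← Nat.cast_sum, Nat.sum_range_choose, ← mul_assoc, pow_succ]
  norm_num

/-! ### Differences of polynomials -/

lemma eval_add_eq_sum_iterate_derivative (Q : ℝ[X]) {N : ℕ} (hN : Q.natDegree < N) (x y : ℝ) :
    Q.eval (x + y) = ∑ j ∈ Finset.range N, (derivative^[j] Q).eval x / (j.factorial : ℝ) * y ^ j := by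
  rw [add_comm, ← taylor_eval, eval_eq_sum_range' (by rwa [natDegree_taylor])]
  refine Finset.sum_congr rfl fun j _ => ?_
  rw [taylor_coeff, ← factorial_smul_hasseDeriv]
  have : (j.factorial : ℝ) ≠ 0 := by positivity
  rw [LinearMap.smul_apply, eval_smul, nsmul_eq_mul]
  field_simp

/-- The `j`-th moment of the `k`-th symmetric difference. -/
noncomputable def diffMoment (k j : ℕ) : ℝ :=
  ∑ i ∈ Finset.range (k + 1), (k.choose i : ℝ) * (-1) ^ (k - i) * ((i : ℝ) - (k : ℝ) / 2) ^ j

/-- The moment is the k-th forward difference at 0 of (X - k/2)^j, a polynomial of degree less than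
k. -/
lemma diffMoment_eq_zero {k j : ℕ} (hj : j < k) : diffMoment k j = 0 := by
  have h1 : ((X - C ((k : ℝ) / 2)) ^ j : ℝ[X]).natDegree < k := by
    rw [natDegree_pow, natDegree_X_sub_C]; omega
  have h2 := congrFun (Polynomial.fwdDiff_iter_eq_zero_of_degree_lt h1) 0
  rw [fwdDiff_iter_eq_sum_shift] at h2
  rw [diffMoment, ← Pi.zero_apply (M := fun _ : ℝ => ℝ) (0 : ℝ), ← h2]
  refine Finset.sum_congr rfl fun i _ => ?_
  simp [mul_comm]

lemma abs_diffMoment_le (k j : ℕ) : |diffMoment k j| ≤ 2 ^ k * (k : ℝ) ^ j := by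
  refine (Finset.abs_sum_le_sum_abs _ _).trans ?_
  have h1 : ∀ i ∈ Finset.range (k + 1),
      |(k.choose i : ℝ) * (-1) ^ (k - i) * ((i : ℝ) - (k : ℝ) / 2) ^ j| ≤
        (k.choose i : ℝ) * (k : ℝ) ^ j := by
    intro i hi
    have hi' : (i : ℝ) ≤ k := by exact_mod_cast Finset.mem_range_succ_iff.1 hi
    have hi0 : (0 : ℝ) ≤ i := Nat.cast_nonneg i
    rw [abs_mul, abs_mul, abs_pow, abs_pow, abs_neg, abs_one, one_pow, mul_one, Nat.abs_cast]
    gcongr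
    exact abs_le.2 ⟨by linarith, by linarith⟩
  refine (Finset.sum_le_sum h1).trans_eq ?_
  rw [← Finset.sum_mul, ← Nat.cast_sum, Nat.sum_range_choose]
  norm_num

lemma sum_diff_eval (k : ℕ) (Q : ℝ[X]) {N : ℕ} (hN : Q.natDegree < N) (s x : ℝ) :
    ∑ i ∈ Finset.range (k + 1),
      (k.choose i : ℝ) * (-1) ^ (k - i) * Q.eval (x + ((i : ℝ) - (k : ℝ) / 2) * s) =
    ∑ j ∈ Finset.range N, diffMoment k j * s ^ j / (j.factorial : ℝ) *
      (derivative^[j] Q).eval x := by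
  simp_rw [eval_add_eq_sum_iterate_derivative Q hN, Finset.mul_sum]
  rw [Finset.sum_comm]
  refine Finset.sum_congr rfl fun j _ => ?_
  rw [diffMoment, Finset.sum_mul, Finset.sum_div, Finset.sum_mul]
  refine Finset.sum_congr rfl fun i _ => ?_
  rw [mul_pow]
  ring

lemma weightedDiff_polynomial_eq_zero {k r : ℕ} (hk : 1 ≤ k) (h : ℝ) {q : ℝ[X]}
    (hq : q ∈ degreeLT ℝ (k + r)) : weightedDiff k r h (fun x => (derivative^[r] q).eval x) = 0 := by
  funext x
  rw [weightedDiff, symmDifference]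
  split_ifs
  · have hd : q.natDegree < k + r := by
      rcases eq_or_ne q 0 with rfl | h0
      · simp; omega
      · exact (natDegree_lt_iff_degree_lt h0).2 (mem_degreeLT.1 hq)
    -- The subtraction in the degree bound is truncated; k ≥ 1 covers the case deg q < r.
    rw [sum_diff_eval k _ (N := k) (by
      have := natDegree_iterate_derivative q r
      omega)]
    rw [Finset.sum_eq_zero, mul_zero, Pi.zero_apply]
    intro j hj
    rw [diffMoment_eq_zero (Finset.mem_range.1 hj)]
    simp
  · simp

/-- As hn ≤ 1, one factor (hn)^k dominates every (hn)^j with j ≥ k; what is left is a partial sum of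
exp(6k). -/
lemma sum_pow_div_factorial_le {k n : ℕ} {h : ℝ} (hh : 0 ≤ h) (hhn : h * n ≤ 1) :
    ∑ j ∈ Finset.Ico k n, (2 ^ k * (k : ℝ) ^ j * h ^ j / (j.factorial : ℝ)) * (6 * n) ^ j ≤
      2 ^ k * Real.exp (6 * k) * (h * n) ^ k := by
  have h0 : 0 ≤ h * n := by positivity
  have h1 : ∀ j ∈ Finset.Ico k n,
      (2 ^ k * (k : ℝ) ^ j * h ^ j / (j.factorial : ℝ)) * (6 * n) ^ j ≤
      2 ^ k * (h * n) ^ k * ((6 * k : ℝ) ^ j / (j.factorial : ℝ)) := by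
    intro j hj
    have h2 : (h * n) ^ j ≤ (h * n) ^ k :=
      pow_le_pow_of_le_one h0 hhn (Finset.mem_Ico.1 hj).1
    calc _ = 2 ^ k * (h * n) ^ j * ((6 * k : ℝ) ^ j / (j.factorial : ℝ)) := by
          simp only [mul_pow]; ring
      _ ≤ _ := by gcongr
  refine (Finset.sum_le_sum h1).trans ?_
  rw [← Finset.mul_sum]
  have h3 : ∑ j ∈ Finset.Ico k n, (6 * k : ℝ) ^ j / (j.factorial : ℝ) ≤ Real.exp (6 * k) := by
    refine le_trans ?_ (Real.sum_le_exp_of_nonneg (by positivity) n)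
    refine Finset.sum_le_sum_of_subset_of_nonneg (fun j hj => ?_) fun j _ _ => by positivity
    exact Finset.mem_range.2 (Finset.mem_Ico.1 hj).2
  calc _ ≤ 2 ^ k * (h * n) ^ k * Real.exp (6 * k) := by gcongr
    _ = _ := by ring

lemma continuous_eval_mul_phi_pow (Q : ℝ[X]) (m : ℕ) :
    Continuous fun u => Q.eval u * phi u ^ m := by
  have := Q.continuous
  have := continuous_phi
  fun_prop

lemma ofReal_six_mul_pow (n m : ℕ) : (6 * (n : ℝ≥0∞)) ^ m = ENNReal.ofReal ((6 * n) ^ m) := by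
  rw [ENNReal.ofReal_pow (by positivity), ENNReal.ofReal_mul (by norm_num), ENNReal.ofReal_natCast]
  norm_num

/-- In the Taylor expansion of the difference the moments below k vanish. The step hφ and the
weight, at most φ, supply φ^(j+r) next to the derivative of order j+r, exactly what Bernstein's
inequality requires. -/
lemma eLpNorm_weightedDiff_polynomial_le_of_small {p : ℝ≥0∞} (hp : 1 ≤ p) (k r : ℕ) {h : ℝ}
    (hh : 0 ≤ h) {n : ℕ} (hhn : h * n ≤ 1) {q : ℝ[X]} (hq : q.natDegree < n) :
    eLpNorm (weightedDiff k r h (fun x => (derivative^[r] q).eval x)) p mu ≤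
      ENNReal.ofReal (2 ^ k * Real.exp (6 * k) * (h * n) ^ k * (6 * n) ^ r) *
        eLpNorm (fun x => q.eval x) p mu := by
  set b : ℕ → ℝ := fun j => 2 ^ k * (k : ℝ) ^ j * h ^ j / (j.factorial : ℝ) with hb
  have hb0 : ∀ j, 0 ≤ b j := fun j => by rw [hb]; positivity
  set F : ℕ → ℝ → ℝ := fun j => b j •
    fun x => |(derivative^[j + r] q).eval x * phi x ^ (j + r)| with hF
  have hFm : ∀ j ∈ Finset.Ico k n, AEStronglyMeasurable (F j) mu := fun j _ =>
    ((continuous_eval_mul_phi_pow _ _).abs.aestronglyMeasurable).const_smul _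
  have hFn : ∀ j ∈ Finset.Ico k n, eLpNorm (F j) p mu ≤
      ENNReal.ofReal (b j * (6 * n) ^ j * (6 * n) ^ r) * eLpNorm (fun x => q.eval x) p mu := by
    intro j _
    rw [hF, eLpNorm_const_smul]
    have h2 : eLpNorm (fun x => |(derivative^[j + r] q).eval x * phi x ^ (j + r)|) p mu =
        eLpNorm (fun x => (derivative^[j + r] q).eval x * phi x ^ (j + r)) p mu :=
      eLpNorm_congr_norm_ae (Filter.Eventually.of_forall fun x => by simp)
    rw [h2, Real.enorm_of_nonneg (hb0 j), mul_assoc (b j), ← pow_add,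
      ENNReal.ofReal_mul (hb0 j), mul_assoc, ← ofReal_six_mul_pow]
    gcongr
    exact eLpNorm_iterate_derivative_mul_phi_pow_le hp hq.le (j + r)
  have hpt : ∀ᵐ x ∂mu, ‖weightedDiff k r h (fun x => (derivative^[r] q).eval x) x‖ ≤
      (∑ j ∈ Finset.Ico k n, F j) x := by
    filter_upwards [ae_mu_mem_Ioo] with x hx
    rw [weightedDiff, symmDifference, Finset.sum_apply]
    by_cases hxD : x ∈ stepDomain (k * h / 2)
    · have hdeg : (derivative^[r] q).natDegree < n := by
        have := natDegree_iterate_derivative q r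
        omega
      rw [if_pos ((mem_Icc_iff_mem_stepDomain hx hh).2 hxD), sum_diff_eval k _ hdeg]
      have hw : weight (k * h) x ≤ phi x := by
        simpa using weight_le_phi_step (c := 0) (by rw [abs_zero]; positivity) hxD
      have hw0 : 0 ≤ weight (k * h) x := Real.sqrt_nonneg _
      have hsub : ∑ j ∈ Finset.range n, diffMoment k j * (h * phi x) ^ j / (j.factorial : ℝ) *
          (derivative^[j] (derivative^[r] q)).eval x =
          ∑ j ∈ Finset.Ico k n, diffMoment k j * (h * phi x) ^ j / (j.factorial : ℝ) *
          (derivative^[j] (derivative^[r] q)).eval x := by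
        refine (Finset.sum_subset (fun j hj => Finset.mem_range.2 (Finset.mem_Ico.1 hj).2)
          fun j hj hj' => ?_).symm
        have : j < k := by
          rw [Finset.mem_range] at hj
          rw [Finset.mem_Ico] at hj'
          omega
        rw [diffMoment_eq_zero this]
        simp
      rw [hsub, norm_mul, norm_pow, Real.norm_of_nonneg hw0]
      calc _ ≤ phi x ^ r * ∑ j ∈ Finset.Ico k n, ‖diffMoment k j * (h * phi x) ^ j /
            (j.factorial : ℝ) * (derivative^[j] (derivative^[r] q)).eval x‖ :=
            mul_le_mul (pow_le_pow_left₀ hw0 hw r) (norm_sum_le _ _) (norm_nonneg _)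
              (pow_nonneg (phi_nonneg x) r)
        _ ≤ _ := by
            rw [Finset.mul_sum]
            refine Finset.sum_le_sum fun j _ => ?_
            have h3 := abs_diffMoment_le k j
            have h4 := phi_nonneg x
            simp only [hF, Pi.smul_apply, smul_eq_mul, hb]
            rw [← Function.iterate_add_apply, norm_mul, norm_div, norm_mul, norm_pow, norm_mul,
              Real.norm_of_nonneg hh, Real.norm_of_nonneg h4, Real.norm_natCast, abs_mul,
              abs_of_nonneg (pow_nonneg h4 _), Real.norm_eq_abs, Real.norm_eq_abs]
            calc _ = |diffMoment k j| * (h ^ j / (j.factorial : ℝ) *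
                  (|(derivative^[j + r] q).eval x| * phi x ^ (j + r))) := by
                  rw [mul_pow, pow_add]; ring
              _ ≤ 2 ^ k * (k : ℝ) ^ j * (h ^ j / (j.factorial : ℝ) *
                  (|(derivative^[j + r] q).eval x| * phi x ^ (j + r))) := by gcongr
              _ = _ := by ring
    · rw [if_neg (fun hcon => hxD ((mem_Icc_iff_mem_stepDomain hx hh).1 hcon)), mul_zero, norm_zero]
      refine Finset.sum_nonneg fun j _ => ?_
      simp only [hF, Pi.smul_apply, smul_eq_mul]
      exact mul_nonneg (hb0 j) (abs_nonneg _)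
  refine (eLpNorm_mono_ae_real hpt).trans ((eLpNorm_sum_le hFm hp).trans
    ((Finset.sum_le_sum hFn).trans ?_))
  rw [← Finset.sum_mul, ← ENNReal.ofReal_sum_of_nonneg
    (fun j _ => by have := hb0 j; positivity), ← Finset.sum_mul]
  gcongr
  exact sum_pow_div_factorial_le hh hhn

/-- The weighted difference of the `r`-th derivative of a polynomial of degree `< n`. -/
lemma eLpNorm_weightedDiff_polynomial_le {p : ℝ≥0∞} (hp : 1 ≤ p) (k r : ℕ) {h : ℝ}
    (hh : 0 ≤ h) {n : ℕ} {q : ℝ[X]} (hq : q.natDegree < n) :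
    eLpNorm (weightedDiff k r h (fun x => (derivative^[r] q).eval x)) p mu ≤
      ENNReal.ofReal (2 ^ (k + 1) * Real.exp (6 * k) * 6 ^ r) *
        (ENNReal.ofReal h ^ k * (n : ℝ≥0∞) ^ (k + r) * eLpNorm (fun x => q.eval x) p mu) := by
  have hrhs : ENNReal.ofReal (2 ^ (k + 1) * Real.exp (6 * k) * 6 ^ r) *
        (ENNReal.ofReal h ^ k * (n : ℝ≥0∞) ^ (k + r) * eLpNorm (fun x => q.eval x) p mu) =
      ENNReal.ofReal (2 ^ (k + 1) * Real.exp (6 * k) * (h * n) ^ k * (6 * n) ^ r) *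
        eLpNorm (fun x => q.eval x) p mu := by
    rw [← ENNReal.ofReal_natCast n, ← ENNReal.ofReal_pow hh, ← ENNReal.ofReal_pow (by positivity),
      ← mul_assoc, ← ENNReal.ofReal_mul (by positivity), ← ENNReal.ofReal_mul (by positivity)]
    congr 2
    rw [mul_pow, mul_pow, pow_add]
    ring
  rw [hrhs]
  -- For hn ≥ 1 no cancellation is needed: the bound for arbitrary functions and Bernstein's
  -- inequality of order r suffice, because (hn)^k ≥ 1.
  rcases le_total (h * n) 1 with hhn | hhn
  · refine (eLpNorm_weightedDiff_polynomial_le_of_small hp k r hh hhn hq).trans ?_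
    gcongr <;> norm_num
  · refine (eLpNorm_weightedDiff_le hp k r hh (derivative^[r] q).continuous.measurable).trans ?_
    refine (mul_le_mul' le_rfl
      (eLpNorm_iterate_derivative_mul_phi_pow_le hp hq.le r)).trans ?_
    rw [ofReal_six_mul_pow, ← mul_assoc]
    have h2 : (2 : ℝ≥0∞) ^ (k + 1) = ENNReal.ofReal (2 ^ (k + 1)) := by
      rw [ENNReal.ofReal_pow (by norm_num)]; norm_num
    rw [h2, ← ENNReal.ofReal_mul (by positivity)]
    gcongr
    have h3 : 1 ≤ Real.exp (6 * k) := Real.one_le_exp (by positivity)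
    have h4 : 1 ≤ (h * n) ^ k := one_le_pow₀ hhn
    have h5 : 1 ≤ Real.exp (6 * k) * (h * n) ^ k := by nlinarith
    rw [mul_assoc (2 ^ (k + 1) : ℝ)]
    exact le_mul_of_one_le_right (by positivity) h5

/-! ### Existence of near-best polynomials -/

lemma memLp_polynomial_eval (q : ℝ[X]) (p : ℝ≥0∞) : MemLp (fun x => q.eval x) p mu := by
  obtain ⟨C, hC⟩ := isCompact_Icc.exists_bound_of_continuousOn
    (f := fun x => q.eval x) (s := Icc (-1 : ℝ) 1) q.continuous.continuousOn
  exact MemLp.of_bound q.continuous.aestronglyMeasurable C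
    ((ae_restrict_mem measurableSet_Icc).mono hC)

/-- Evaluation of polynomials, as a linear map into `L_p[-1, 1]`. -/
noncomputable def polyToLp (p : ℝ≥0∞) : ℝ[X] →ₗ[ℝ] Lp ℝ p mu where
  toFun q := (memLp_polynomial_eval q p).toLp _
  map_add' q₁ q₂ := by
    rw [← MemLp.toLp_add]
    congr 1
    funext x
    simp
  map_smul' c q := by
    rw [RingHom.id_apply, ← MemLp.toLp_const_smul]
    congr 1
    funext x
    simp

lemma approxError_le_eLpNorm (n : ℕ) (f : ℝ → ℝ) (p : ℝ≥0∞) : approxError n f p ≤ eLpNorm f p mu := by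
  refine (iInf₂_le (0 : ℝ[X]) (Submodule.zero_mem _)).trans_eq ?_
  simp

lemma approxError_antitone (f : ℝ → ℝ) (p : ℝ≥0∞) : Antitone fun n => approxError n f p :=
  fun _ _ hmn => le_iInf₂ fun q hq => iInf₂_le q (degreeLT_mono hmn hq)

/-- Polynomials of degree below n form a finite-dimensional, hence closed, subspace of L_p. This
settles the case of zero error, where twice the infimum leaves no room above the infimum. -/
lemma exists_eLpNorm_sub_eq_zero {p : ℝ≥0∞} (hp : 1 ≤ p) {n : ℕ} {f : ℝ → ℝ} (hf : MemLp f p mu)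
    (h0 : approxError n f p = 0) :
    ∃ q ∈ degreeLT ℝ n, eLpNorm (fun x => f x - q.eval x) p mu = 0 := by
  have : Fact (1 ≤ p) := ⟨hp⟩
  have : FiniteDimensional ℝ (degreeLT ℝ n) := (degreeLTEquiv ℝ n).symm.finiteDimensional
  set V : Submodule ℝ (Lp ℝ p mu) := (degreeLT ℝ n).map (polyToLp p)
  have hV : IsClosed (V : Set (Lp ℝ p mu)) := V.closed_of_finiteDimensional
  have hmem : hf.toLp f ∈ closure (V : Set (Lp ℝ p mu)) := by
    rw [EMetric.mem_closure_iff]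
    intro ε hε
    have h1 : approxError n f p < ε := by rwa [h0]
    simp only [approxError, iInf_lt_iff] at h1
    obtain ⟨q, hq, hlt⟩ := h1
    refine ⟨polyToLp p q, Submodule.mem_map_of_mem hq, ?_⟩
    change edist (hf.toLp f) ((memLp_polynomial_eval q p).toLp _) < ε
    rw [Lp.edist_toLp_toLp]
    exact hlt
  rw [hV.closure_eq] at hmem
  obtain ⟨q, hq, hqf⟩ := hmem
  refine ⟨q, hq, ?_⟩
  have h2 : edist (hf.toLp f) ((memLp_polynomial_eval q p).toLp _) = 0 := by
    rw [edist_eq_zero]; exact hqf.symm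
  rw [Lp.edist_toLp_toLp] at h2
  exact h2

lemma exists_near_best {p : ℝ≥0∞} (hp : 1 ≤ p) {f : ℝ → ℝ} (hf : MemLp f p mu) (n : ℕ) :
    ∃ q ∈ degreeLT ℝ n, eLpNorm (fun x => f x - q.eval x) p mu ≤ 2 * approxError n f p := by
  rcases eq_or_ne (approxError n f p) 0 with h0 | h0
  · obtain ⟨q, hq, h⟩ := exists_eLpNorm_sub_eq_zero hp hf h0
    exact ⟨q, hq, h.le.trans zero_le⟩
  · have hfin : approxError n f p ≠ ∞ := ((approxError_le_eLpNorm n f p).trans_lt hf.2).ne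
    have h1 : approxError n f p < 2 * approxError n f p := by
      rw [two_mul]; exact ENNReal.lt_add_right hfin h0
    rw [approxError] at h1
    simp only [iInf_lt_iff] at h1
    obtain ⟨q, hq, hlt⟩ := h1
    exact ⟨q, hq, hlt.le⟩

/-! ### Dyadic summation -/

/-- The block (L/2, L] has at least L/2 members, and on it L ≤ 2n and E_L ≤ E_n; hence the factor 2
· 2^(s-1). -/
lemma pow_mul_le_sum_Ioc {E : ℕ → ℝ≥0∞} (hE : Antitone E) {s : ℕ} (hs : 1 ≤ s) (L : ℕ) :
    (L : ℝ≥0∞) ^ s * E L ≤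
      2 ^ s * ∑ n ∈ Finset.Ioc (L / 2) L, (n : ℝ≥0∞) ^ (s - 1) * E n := by
  obtain ⟨s, rfl⟩ := Nat.exists_eq_add_of_le' hs
  rw [Nat.add_sub_cancel]
  have h1 : ∀ n ∈ Finset.Ioc (L / 2) L, (L : ℝ≥0∞) ^ s * E L ≤ 2 ^ s * ((n : ℝ≥0∞) ^ s * E n) := by
    intro n hn
    rw [Finset.mem_Ioc] at hn
    rw [← mul_assoc, ← mul_pow]
    have h2 : (L : ℝ≥0∞) ≤ 2 * n := by exact_mod_cast (by omega : L ≤ 2 * n)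
    exact mul_le_mul' (pow_le_pow_left' h2 s) (hE hn.2)
  have h3 : (L : ℝ≥0∞) ≤ 2 * ((Finset.Ioc (L / 2) L).card : ℝ≥0∞) := by
    rw [Nat.card_Ioc]
    exact_mod_cast (by omega : L ≤ 2 * (L - L / 2))
  calc (L : ℝ≥0∞) ^ (s + 1) * E L = L * ((L : ℝ≥0∞) ^ s * E L) := by ring
    _ ≤ 2 * ((Finset.Ioc (L / 2) L).card : ℝ≥0∞) * ((L : ℝ≥0∞) ^ s * E L) := by gcongr
    _ = 2 * ∑ n ∈ Finset.Ioc (L / 2) L, (L : ℝ≥0∞) ^ s * E L := by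
        rw [Finset.sum_const, nsmul_eq_mul, mul_assoc]
    _ ≤ 2 * ∑ n ∈ Finset.Ioc (L / 2) L, 2 ^ s * ((n : ℝ≥0∞) ^ s * E n) := by
        exact mul_le_mul' le_rfl (Finset.sum_le_sum h1)
    _ = _ := by rw [← Finset.mul_sum]; ring

/-- A dyadic decomposition: if a "distance" `d` between the `M`-th and the `K`-th approximant is
at most `K ^ s E_M`, then it is controlled by a sum which does not depend on `K` much. -/
lemma dist_le_of_dyadic {E : ℕ → ℝ≥0∞} (hE : Antitone E) {s : ℕ} {B : ℝ≥0∞} {d : ℕ → ℕ → ℝ≥0∞}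
    (hd : ∀ M K, 1 ≤ M → M ≤ K → d M K ≤ B * ((K : ℝ≥0∞) ^ s * E M))
    (tri : ∀ M L K, d M K ≤ d M L + d L K) {M : ℕ} (hM : 1 ≤ M) (K : ℕ) (hMK : M ≤ K) :
    d M K ≤ 6 ^ s * B * ((M : ℝ≥0∞) ^ s * E M +
      ∑ n ∈ Finset.Ioc M (K / 2), (s : ℝ≥0∞) * ((n : ℝ≥0∞) ^ (s - 1) * E n)) := by
  -- For s = 0 the factor s removes the sum and the hypothesis is the claim; there is no growth in K
  -- to repair.
  rcases Nat.eq_zero_or_pos s with rfl | hs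
  · simpa using hd M K hM hMK
  induction K using Nat.strong_induction_on with
  | _ K ih =>
    rcases lt_or_ge K (4 * M) with hK | hK
    · refine (hd M K hM hMK).trans ?_
      have h1 : (K : ℝ≥0∞) ≤ 6 * M := by exact_mod_cast (by omega : K ≤ 6 * M)
      calc B * ((K : ℝ≥0∞) ^ s * E M) ≤ B * ((6 * M : ℝ≥0∞) ^ s * E M) := by gcongr
        _ = 6 ^ s * B * ((M : ℝ≥0∞) ^ s * E M) := by rw [mul_pow]; ring
        _ ≤ _ := by gcongr; exact le_self_add
    -- Passing through L costs only the block (L/2, L], disjoint from the sum already used for L, so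
    -- the constant does not grow. Here K ≤ 3L gives 3^s and the block estimate 2^s.
    · set L := K / 2 with hL
      have hML : M ≤ L / 2 := by omega
      have h1 := ih L (by omega) (by omega)
      have h2 := hd L K (by omega) (by omega)
      have h3 : (K : ℝ≥0∞) ≤ 3 * L := by exact_mod_cast (by omega : K ≤ 3 * L)
      have h4 : d L K ≤ 6 ^ s * B *
          ∑ n ∈ Finset.Ioc (L / 2) L, (s : ℝ≥0∞) * ((n : ℝ≥0∞) ^ (s - 1) * E n) := by
        calc d L K ≤ B * ((3 * L : ℝ≥0∞) ^ s * E L) := h2.trans (by gcongr)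
          _ = B * 3 ^ s * ((L : ℝ≥0∞) ^ s * E L) := by rw [mul_pow]; ring
          _ ≤ B * 3 ^ s * (2 ^ s * ∑ n ∈ Finset.Ioc (L / 2) L, (n : ℝ≥0∞) ^ (s - 1) * E n) := by
              exact mul_le_mul' le_rfl (pow_mul_le_sum_Ioc hE hs L)
          _ = 6 ^ s * B * ∑ n ∈ Finset.Ioc (L / 2) L, (n : ℝ≥0∞) ^ (s - 1) * E n := by
              rw [show (6 : ℝ≥0∞) = 3 * 2 by norm_num, mul_pow]; ring
          _ ≤ _ := by
              refine mul_le_mul' le_rfl (Finset.sum_le_sum fun n _ => ?_)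
              refine le_mul_of_one_le_left zero_le ?_
              exact_mod_cast hs
      have h5 : Finset.Ioc M L = Finset.Ioc M (L / 2) ∪ Finset.Ioc (L / 2) L :=
        (Finset.Ioc_union_Ioc_eq_Ioc hML (Nat.div_le_self L 2)).symm
      have h6 : Disjoint (Finset.Ioc M (L / 2)) (Finset.Ioc (L / 2) L) := by
        rw [Finset.disjoint_left]
        intro n h7 h8
        rw [Finset.mem_Ioc] at h7 h8
        omega
      refine (tri M L K).trans ((add_le_add h1 h4).trans_eq ?_)
      rw [h5, Finset.sum_union h6]
      ring

/-! ### Differences of near-best polynomials -/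

/-- `q n` is, for each `n`, a polynomial of degree `< n` which approximates `f` up to twice the
optimal error. -/
structure IsNearBest (p : ℝ≥0∞) (f : ℝ → ℝ) (q : ℕ → ℝ[X]) : Prop where
  mem : ∀ n, q n ∈ degreeLT ℝ n
  le : ∀ n, eLpNorm (fun x => f x - (q n).eval x) p mu ≤ 2 * approxError n f p

lemma natDegree_lt_of_mem_degreeLT {n : ℕ} (hn : 1 ≤ n) {q : ℝ[X]} (hq : q ∈ degreeLT ℝ n) :
    q.natDegree < n := by
  rcases eq_or_ne q 0 with rfl | h0
  · simp; omega
  · exact (natDegree_lt_iff_degree_lt h0).2 (mem_degreeLT.1 hq)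

namespace IsNearBest

variable {p : ℝ≥0∞} {f : ℝ → ℝ} {q : ℕ → ℝ[X]}

lemma natDegree_sub_lt (h : IsNearBest p f q) {M K : ℕ} (hM : 1 ≤ M) (hMK : M ≤ K) :
    (q K - q M).natDegree < K :=
  natDegree_lt_of_mem_degreeLT (hM.trans hMK)
    (Submodule.sub_mem _ (h.mem K) (degreeLT_mono hMK (h.mem M)))

lemma eLpNorm_sub_le (h : IsNearBest p f q) (hp : 1 ≤ p) (hf : AEStronglyMeasurable f mu) {M K : ℕ}
    (hMK : M ≤ K) : eLpNorm (fun x => (q K - q M).eval x) p mu ≤ 4 * approxError M f p := by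
  have hm : ∀ n, AEStronglyMeasurable (fun x => f x - (q n).eval x) mu := fun n =>
    hf.sub (q n).continuous.aestronglyMeasurable
  have heq : (fun x => (q K - q M).eval x) =
      (fun x => f x - (q M).eval x) - fun x => f x - (q K).eval x := by
    funext x
    simp
  rw [heq]
  calc _ ≤ 2 * approxError M f p + 2 * approxError K f p :=
        (MeasureTheory.eLpNorm_sub_le (hm M) (hm K) hp).trans (add_le_add (h.le M) (h.le K))
    _ ≤ 2 * approxError M f p + 2 * approxError M f p := by
        gcongr; exact approxError_antitone f p hMK
    _ = 4 * approxError M f p := by ring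

lemma eLpNorm_derivative_sub_le (h : IsNearBest p f q) (hp : 1 ≤ p)
    (hf : AEStronglyMeasurable f mu) (r : ℕ) {M K : ℕ} (hM : 1 ≤ M) (hMK : M ≤ K) :
    eLpNorm (fun x => (derivative^[r] (q K - q M)).eval x * phi x ^ r) p mu ≤
      4 * 6 ^ r * ((K : ℝ≥0∞) ^ r * approxError M f p) := by
  refine (eLpNorm_iterate_derivative_mul_phi_pow_le hp (h.natDegree_sub_lt hM hMK).le r).trans ?_
  refine (mul_le_mul' le_rfl (h.eLpNorm_sub_le hp hf hMK)).trans_eq ?_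
  rw [mul_pow]
  ring

/-- Bernstein's inequality alone gives K^r E_M, which is useless as K → ∞. The dyadic form is
controlled by the tail of the convergent series. -/
lemma eLpNorm_derivative_sub_le_sum (h : IsNearBest p f q) (hp : 1 ≤ p)
    (hf : AEStronglyMeasurable f mu) (r : ℕ) {M K : ℕ} (hM : 1 ≤ M) (hMK : M ≤ K) :
    eLpNorm (fun x => (derivative^[r] (q K - q M)).eval x * phi x ^ r) p mu ≤
      6 ^ r * (4 * 6 ^ r) * ((M : ℝ≥0∞) ^ r * approxError M f p +
      ∑ n ∈ Finset.Ioc M (K / 2), (r : ℝ≥0∞) * ((n : ℝ≥0∞) ^ (r - 1) * approxError n f p)) := by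
  refine dist_le_of_dyadic (approxError_antitone f p)
    (d := fun M K => eLpNorm (fun x => (derivative^[r] (q K - q M)).eval x * phi x ^ r) p mu)
    (fun M K hM hMK => h.eLpNorm_derivative_sub_le hp hf r hM hMK) (fun M L K => ?_) hM K hMK
  have heq : (fun x => (derivative^[r] (q K - q M)).eval x * phi x ^ r) =
      (fun x => (derivative^[r] (q L - q M)).eval x * phi x ^ r) +
      fun x => (derivative^[r] (q K - q L)).eval x * phi x ^ r := by
    funext x
    simp only [iterate_derivative_sub, eval_sub, Pi.add_apply]
    ring
  rw [heq]
  exact eLpNorm_add_le (continuous_eval_mul_phi_pow _ r).aestronglyMeasurable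
    (continuous_eval_mul_phi_pow _ r).aestronglyMeasurable hp

lemma eLpNorm_weightedDiff_sub_le_sum (h : IsNearBest p f q) (hp : 1 ≤ p)
    (hf : AEStronglyMeasurable f mu) (k r : ℕ) {δ : ℝ} (hδ : 0 ≤ δ) {M K : ℕ} (hM : 1 ≤ M)
    (hMK : M ≤ K) :
    eLpNorm (weightedDiff k r δ fun x => (derivative^[r] (q K - q M)).eval x) p mu ≤
      6 ^ (k + r) * (ENNReal.ofReal (2 ^ (k + 1) * Real.exp (6 * k) * 6 ^ r) * 4 *
        ENNReal.ofReal δ ^ k) * ((M : ℝ≥0∞) ^ (k + r) * approxError M f p +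
      ∑ n ∈ Finset.Ioc M (K / 2),
        ((k + r : ℕ) : ℝ≥0∞) * ((n : ℝ≥0∞) ^ (k + r - 1) * approxError n f p)) := by
  refine dist_le_of_dyadic (approxError_antitone f p)
    (d := fun M K => eLpNorm (weightedDiff k r δ fun x => (derivative^[r] (q K - q M)).eval x) p mu)
    (fun M K hM hMK => ?_) (fun M L K => ?_) hM K hMK
  · refine (eLpNorm_weightedDiff_polynomial_le hp k r hδ (h.natDegree_sub_lt hM hMK)).trans ?_
    calc _ ≤ ENNReal.ofReal (2 ^ (k + 1) * Real.exp (6 * k) * 6 ^ r) * (ENNReal.ofReal δ ^ k *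
          (K : ℝ≥0∞) ^ (k + r) * (4 * approxError M f p)) := by
          gcongr; exact h.eLpNorm_sub_le hp hf hMK
      _ = _ := by ring
  · have heq : (fun x => (derivative^[r] (q K - q M)).eval x) =
        fun x => (derivative^[r] (q L - q M)).eval x + (derivative^[r] (q K - q L)).eval x := by
      funext x
      simp only [iterate_derivative_sub, eval_sub]
      ring
    change eLpNorm (weightedDiff k r δ fun x => (derivative^[r] (q K - q M)).eval x) p mu ≤ _
    rw [heq]
    exact eLpNorm_weightedDiff_add_le hp k r δ (Polynomial.continuous _).measurable
      (Polynomial.continuous _).measurable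

end IsNearBest

/-! ### Termwise differentiation of series of polynomials -/

/-- The `i`-th derivatives of the polynomials `u j` are absolutely summable in `L_1` on compact
subintervals of `(-1, 1)`. -/
def DerivLocallySummable (u : ℕ → ℝ[X]) (i : ℕ) : Prop :=
  ∀ ρ : ℝ, 0 < ρ → ρ < 1 →
    ∑' j, ∫⁻ x in Icc (-ρ) ρ, ‖(derivative^[i] (u j)).eval x‖ₑ ≠ ∞

/-- The formal `i`-th derivative of the series `∑ u j`. -/
noncomputable def derivSeries (u : ℕ → ℝ[X]) (i : ℕ) (x : ℝ) : ℝ :=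
  ∑' j, (derivative^[i] (u j)).eval x

/-- On [-ρ, ρ] the weight is at least φ(ρ)^i, and Hölder's inequality on the finite measure space
passes from L_1 to L_p. -/
lemma lintegral_Icc_le_eLpNorm {p : ℝ≥0∞} (hp : 1 ≤ p) {ρ : ℝ} (h0 : 0 < ρ) (h1 : ρ < 1) (i : ℕ) :
    ∃ C : ℝ≥0∞, C ≠ ∞ ∧ ∀ v : ℝ[X], ∫⁻ x in Icc (-ρ) ρ, ‖v.eval x‖ₑ ≤
      C * eLpNorm (fun x => v.eval x * phi x ^ i) p mu := by
  have ha : 0 < phi ρ := phi_pos ⟨by linarith, h1⟩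
  have hE : 0 ≤ 1 / (1 : ℝ≥0∞).toReal - 1 / p.toReal := by
    rw [ENNReal.toReal_one, div_one, sub_nonneg]
    rcases eq_or_ne p ∞ with rfl | hpt
    · simp
    · have : 1 ≤ p.toReal := by simpa using ENNReal.toReal_mono hpt hp
      rw [div_le_one (by linarith)]
      exact this
  refine ⟨ENNReal.ofReal ((phi ρ ^ i)⁻¹) * mu univ ^ (1 / (1 : ℝ≥0∞).toReal - 1 / p.toReal),
    ENNReal.mul_ne_top ENNReal.ofReal_ne_top
      (ENNReal.rpow_ne_top_of_nonneg hE (measure_ne_top _ _)), fun v => ?_⟩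
  have h2 : ∀ x ∈ Icc (-ρ) ρ, ‖v.eval x‖ₑ ≤
      ENNReal.ofReal ((phi ρ ^ i)⁻¹) * ‖v.eval x * phi x ^ i‖ₑ := by
    intro x hx
    have h3 : phi ρ ≤ phi x := Real.sqrt_le_sqrt (by nlinarith [hx.1, hx.2])
    have h4 : phi ρ ^ i ≤ phi x ^ i := pow_le_pow_left₀ ha.le h3 i
    have h5 : 0 < phi ρ ^ i := pow_pos ha i
    rw [← ofReal_norm, ← ofReal_norm, ← ENNReal.ofReal_mul (by positivity)]
    refine ENNReal.ofReal_le_ofReal ?_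
    rw [norm_mul, norm_pow, Real.norm_of_nonneg (phi_nonneg x), inv_mul_eq_div, le_div_iff₀ h5]
    exact mul_le_mul_of_nonneg_left h4 (norm_nonneg _)
  calc ∫⁻ x in Icc (-ρ) ρ, ‖v.eval x‖ₑ
      ≤ ∫⁻ x in Icc (-ρ) ρ, ENNReal.ofReal ((phi ρ ^ i)⁻¹) * ‖v.eval x * phi x ^ i‖ₑ :=
        setLIntegral_mono' measurableSet_Icc h2
    _ ≤ ∫⁻ x in Icc (-1) 1, ENNReal.ofReal ((phi ρ ^ i)⁻¹) * ‖v.eval x * phi x ^ i‖ₑ :=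
        lintegral_mono_set (Icc_subset_Icc (by linarith) h1.le)
    _ = ENNReal.ofReal ((phi ρ ^ i)⁻¹) * eLpNorm (fun x => v.eval x * phi x ^ i) 1 mu := by
        rw [lintegral_const_mul' _ _ ENNReal.ofReal_ne_top, eLpNorm_one_eq_lintegral_enorm, mu]
    _ ≤ ENNReal.ofReal ((phi ρ ^ i)⁻¹) * (eLpNorm (fun x => v.eval x * phi x ^ i) p mu *
          mu univ ^ (1 / (1 : ℝ≥0∞).toReal - 1 / p.toReal)) := by
        gcongr
        exact eLpNorm_le_eLpNorm_mul_rpow_measure_univ hp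
          (continuous_eval_mul_phi_pow v i).aestronglyMeasurable
    _ = _ := by ring

lemma derivLocallySummable_of_eLpNorm {p : ℝ≥0∞} (hp : 1 ≤ p) {u : ℕ → ℝ[X]} {i : ℕ}
    (h : ∑' j, eLpNorm (fun x => (derivative^[i] (u j)).eval x * phi x ^ i) p mu ≠ ∞) :
    DerivLocallySummable u i := by
  intro ρ h0 h1
  obtain ⟨C, hC, hle⟩ := lintegral_Icc_le_eLpNorm hp h0 h1 i
  refine ne_top_of_le_ne_top (ENNReal.mul_ne_top hC h) ?_
  rw [← ENNReal.tsum_mul_left]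
  exact ENNReal.tsum_le_tsum fun j => hle _

/-- For every y, |v(x)| ≤ |v(y)| + ∫|v'|; average over y. -/
lemma enorm_eval_le_lintegral {ρ : ℝ} (h0 : 0 < ρ) (v : ℝ[X]) {x : ℝ} (hx : x ∈ Icc (-ρ) ρ) :
    ‖v.eval x‖ₑ ≤ (ENNReal.ofReal (2 * ρ))⁻¹ * (∫⁻ y in Icc (-ρ) ρ, ‖v.eval y‖ₑ) +
      ∫⁻ y in Icc (-ρ) ρ, ‖v.derivative.eval y‖ₑ := by
  set J := ∫⁻ y in Icc (-ρ) ρ, ‖v.derivative.eval y‖ₑ with hJ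
  have hc0 : ENNReal.ofReal (2 * ρ) ≠ 0 := by
    rw [Ne, ENNReal.ofReal_eq_zero]; linarith
  have hpt : ∀ y ∈ Icc (-ρ) ρ, ‖v.eval x‖ₑ ≤ ‖v.eval y‖ₑ + J := by
    intro y hy
    have hftc : ∫ t in y..x, v.derivative.eval t = v.eval x - v.eval y :=
      intervalIntegral.integral_eq_sub_of_hasDerivAt (fun t _ => v.hasDerivAt t)
        (v.derivative.continuous.intervalIntegrable _ _)
    have h2 : ‖v.eval x - v.eval y‖ₑ ≤ J := by
      rw [← hftc, ← ofReal_norm, intervalIntegral.norm_integral_eq_norm_integral_uIoc, ofReal_norm]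
      refine (enorm_integral_le_lintegral_enorm _).trans (lintegral_mono_set ?_)
      exact uIoc_subset_uIcc.trans (uIcc_subset_Icc hy hx)
    calc ‖v.eval x‖ₑ = ‖v.eval y + (v.eval x - v.eval y)‖ₑ := by rw [add_sub_cancel]
      _ ≤ ‖v.eval y‖ₑ + ‖v.eval x - v.eval y‖ₑ := enorm_add_le _ _
      _ ≤ _ := by gcongr
  have hint : ENNReal.ofReal (2 * ρ) * ‖v.eval x‖ₑ ≤
      (∫⁻ y in Icc (-ρ) ρ, ‖v.eval y‖ₑ) + ENNReal.ofReal (2 * ρ) * J := by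
    have h3 := setLIntegral_mono' (μ := volume) measurableSet_Icc hpt
    rw [lintegral_add_right _ measurable_const, setLIntegral_const, setLIntegral_const,
      Real.volume_Icc, show ρ - -ρ = 2 * ρ by ring] at h3
    rwa [mul_comm, mul_comm _ J]
  calc ‖v.eval x‖ₑ = (ENNReal.ofReal (2 * ρ))⁻¹ * (ENNReal.ofReal (2 * ρ) * ‖v.eval x‖ₑ) := by
        rw [← mul_assoc, ENNReal.inv_mul_cancel hc0 ENNReal.ofReal_ne_top, one_mul]
    _ ≤ (ENNReal.ofReal (2 * ρ))⁻¹ *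
        ((∫⁻ y in Icc (-ρ) ρ, ‖v.eval y‖ₑ) + ENNReal.ofReal (2 * ρ) * J) := by gcongr
    _ = _ := by
        rw [mul_add, ← mul_assoc _ _ J, ENNReal.inv_mul_cancel hc0 ENNReal.ofReal_ne_top, one_mul]

/-- L_1 summability of two consecutive derivatives gives Weierstrass majorants for the lower one.
Hence uniform convergence reaches order R, while at order R+1 only L_1 and almost everywhere
convergence remain. -/
lemma exists_summable_bound {u : ℕ → ℝ[X]} {i : ℕ} (h : DerivLocallySummable u i)
    (h' : DerivLocallySummable u (i + 1)) {ρ : ℝ} (h0 : 0 < ρ) (h1 : ρ < 1) :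
    ∃ b : ℕ → ℝ, Summable b ∧
      ∀ j, ∀ x ∈ Icc (-ρ) ρ, ‖(derivative^[i] (u j)).eval x‖ ≤ b j := by
  set b : ℕ → ℝ≥0∞ := fun j =>
    (ENNReal.ofReal (2 * ρ))⁻¹ * (∫⁻ y in Icc (-ρ) ρ, ‖(derivative^[i] (u j)).eval y‖ₑ) +
      ∫⁻ y in Icc (-ρ) ρ, ‖(derivative^[i + 1] (u j)).eval y‖ₑ with hb
  have hc0 : ENNReal.ofReal (2 * ρ) ≠ 0 := by
    rw [Ne, ENNReal.ofReal_eq_zero]; linarith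
  have hbs : ∑' j, b j ≠ ∞ := by
    simp only [hb]
    rw [ENNReal.tsum_add, ENNReal.tsum_mul_left]
    exact ENNReal.add_ne_top.2 ⟨ENNReal.mul_ne_top (ENNReal.inv_ne_top.2 hc0) (h ρ h0 h1),
      h' ρ h0 h1⟩
  refine ⟨fun j => (b j).toReal, ENNReal.summable_toReal hbs, fun j x hx => ?_⟩
  have h2 := enorm_eval_le_lintegral h0 (derivative^[i] (u j)) hx
  rw [← Function.iterate_succ_apply' (f := ⇑derivative)] at h2
  rw [← ofReal_norm] at h2
  exact (ENNReal.ofReal_le_iff_le_toReal (ENNReal.ne_top_of_tsum_ne_top hbs j)).1 h2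

lemma exists_rho {a b : ℝ} (ha : a ∈ Ioo (-1 : ℝ) 1) (hb : b ∈ Ioo (-1 : ℝ) 1) :
    ∃ ρ : ℝ, 0 < ρ ∧ ρ < 1 ∧ a ∈ Ioo (-ρ) ρ ∧ b ∈ Ioo (-ρ) ρ := by
  obtain ⟨ρ, h1, h2⟩ := exists_between (max_lt (abs_lt.2 ha) (abs_lt.2 hb))
  have ha' := (le_max_left _ _).trans_lt h1
  have hb' := (le_max_right _ _).trans_lt h1
  exact ⟨ρ, (abs_nonneg a).trans_lt ha', h2, abs_lt.1 ha', abs_lt.1 hb'⟩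

section Series

variable {u : ℕ → ℝ[X]} {R : ℕ}

lemma summable_derivSeries (hS : ∀ i ≤ R + 1, DerivLocallySummable u i) {i : ℕ} (hi : i ≤ R) {x : ℝ}
    (hx : x ∈ Ioo (-1 : ℝ) 1) : Summable fun j => (derivative^[i] (u j)).eval x := by
  obtain ⟨ρ, h0, h1, hxρ, -⟩ := exists_rho hx hx
  obtain ⟨b, hb, hle⟩ := exists_summable_bound (hS i (by omega)) (hS (i + 1) (by omega)) h0 h1
  exact Summable.of_norm_bounded hb fun j => hle j x (Ioo_subset_Icc_self hxρ)

lemma hasDerivAt_derivSeries (hS : ∀ i ≤ R + 1, DerivLocallySummable u i) {i : ℕ} (hi : i + 1 ≤ R)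
    {x : ℝ} (hx : x ∈ Ioo (-1 : ℝ) 1) :
    HasDerivAt (derivSeries u i) (derivSeries u (i + 1) x) x := by
  obtain ⟨ρ, h0, h1, hxρ, -⟩ := exists_rho hx hx
  obtain ⟨b, hb, hle⟩ := exists_summable_bound (hS (i + 1) (by omega)) (hS (i + 2) (by omega)) h0 h1
  exact hasDerivAt_tsum_of_isPreconnected (t := Ioo (-ρ) ρ) hb isOpen_Ioo isPreconnected_Ioo
    (g := fun j y => (derivative^[i] (u j)).eval y)
    (g' := fun j y => (derivative^[i + 1] (u j)).eval y)
    (fun j y _ => by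
      rw [Function.iterate_succ_apply']
      exact Polynomial.hasDerivAt _ _)
    (fun j y hy => hle j y (Ioo_subset_Icc_self hy)) hxρ
    (summable_derivSeries hS (by omega) hx) hxρ

lemma continuousOn_derivSeries (hS : ∀ i ≤ R + 1, DerivLocallySummable u i) {i : ℕ} (hi : i ≤ R) :
    ContinuousOn (derivSeries u i) (Ioo (-1) 1) := by
  intro x hx
  obtain ⟨ρ, h0, h1, hxρ, -⟩ := exists_rho hx hx
  obtain ⟨b, hb, hle⟩ := exists_summable_bound (hS i (by omega)) (hS (i + 1) (by omega)) h0 h1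
  have h2 : ContinuousOn (derivSeries u i) (Icc (-ρ) ρ) :=
    continuousOn_tsum (fun j => (Polynomial.continuous _).continuousOn) hb hle
  exact (h2.continuousAt (Icc_mem_nhds hxρ.1 hxρ.2)).continuousWithinAt

lemma contDiffOn_derivSeries (hS : ∀ i ≤ R + 1, DerivLocallySummable u i) (m : ℕ) :
    ∀ i, i + m ≤ R → ContDiffOn ℝ (m : WithTop ℕ∞) (derivSeries u i) (Ioo (-1) 1) := by
  induction m with
  | zero =>
    intro i hi
    exact contDiffOn_zero.2 (continuousOn_derivSeries hS (by omega))
  | succ m ih =>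
    intro i hi
    push_cast
    rw [contDiffOn_succ_iff_deriv_of_isOpen isOpen_Ioo]
    have hd : ∀ x ∈ Ioo (-1 : ℝ) 1, HasDerivAt (derivSeries u i) (derivSeries u (i + 1) x) x :=
      fun x hx => hasDerivAt_derivSeries hS (by omega) hx
    refine ⟨fun x hx => (hd x hx).differentiableAt.differentiableWithinAt, by simp, ?_⟩
    exact (ih (i + 1) (by omega)).congr fun x hx => (hd x hx).deriv

lemma iteratedDeriv_derivSeries (hS : ∀ i ≤ R + 1, DerivLocallySummable u i) {i : ℕ} (hi : i ≤ R) :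
    EqOn (iteratedDeriv i (derivSeries u 0)) (derivSeries u i) (Ioo (-1) 1) := by
  induction i with
  | zero => intro x _; simp
  | succ i ih =>
    intro x hx
    rw [iteratedDeriv_succ]
    have h1 : iteratedDeriv i (derivSeries u 0) =ᶠ[nhds x] derivSeries u i :=
      (ih (by omega)).eventuallyEq_of_mem (isOpen_Ioo.mem_nhds hx)
    rw [h1.deriv_eq]
    exact (hasDerivAt_derivSeries hS hi hx).deriv

lemma ae_summable_derivSeries {i : ℕ} (h : DerivLocallySummable u i) {ρ : ℝ} (h0 : 0 < ρ)
    (h1 : ρ < 1) : ∀ᵐ x ∂volume.restrict (Icc (-ρ) ρ),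
      Summable fun j => (derivative^[i] (u j)).eval x := by
  have hm : ∀ j, Measurable fun x => ‖(derivative^[i] (u j)).eval x‖ₑ := fun j =>
    (Polynomial.continuous _).measurable.enorm
  have h2 := h ρ h0 h1
  rw [← lintegral_tsum fun j => (hm j).aemeasurable] at h2
  filter_upwards [ae_lt_top (Measurable.tsum hm) h2] with x hx
  exact (tsum_enorm_ne_top_iff_summable_norm.1 hx.ne).of_norm

lemma integrableOn_derivSeries {i : ℕ} (h : DerivLocallySummable u i) {ρ : ℝ} (h0 : 0 < ρ)
    (h1 : ρ < 1) : IntegrableOn (derivSeries u i) (Icc (-ρ) ρ) := by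
  have hm : ∀ j, Measurable fun x => ‖(derivative^[i] (u j)).eval x‖ₑ := fun j =>
    (Polynomial.continuous _).measurable.enorm
  refine ⟨?_, ?_⟩
  · refine aestronglyMeasurable_of_tendsto_ae Filter.atTop
      (f := fun n x => ∑ j ∈ Finset.range n, (derivative^[i] (u j)).eval x) (fun n => ?_) ?_
    · exact (continuous_finsetSum _ fun j _ => Polynomial.continuous _).aestronglyMeasurable
    · filter_upwards [ae_summable_derivSeries h h0 h1] with x hx
      exact hx.hasSum.tendsto_sum_nat
  · refine lt_of_le_of_lt ?_ (h ρ h0 h1).lt_top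
    rw [← lintegral_tsum fun j => (hm j).aemeasurable]
    exact lintegral_mono fun x => enorm_tsum_le_tsum_enorm

/-- Sum the fundamental theorem of calculus over j; summability in L_1 allows the interchange. Local
absolute continuity of the R-th derivative is read off from this formula. -/
lemma derivSeries_eq_integral (hS : ∀ i ≤ R + 1, DerivLocallySummable u i) {ρ : ℝ} (h0 : 0 < ρ)
    (h1 : ρ < 1) {x : ℝ} (hx : x ∈ Icc (-ρ) ρ) :
    derivSeries u R x = derivSeries u R 0 + ∫ t in (0 : ℝ)..x, derivSeries u (R + 1) t := by
  have hρ : Icc (-ρ) ρ ⊆ Ioo (-1) 1 := fun y hy => ⟨by linarith [hy.1], by linarith [hy.2]⟩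
  have h0m : (0 : ℝ) ∈ Icc (-ρ) ρ := ⟨by linarith, h0.le⟩
  have hsx := summable_derivSeries hS le_rfl (hρ hx)
  have hs0 := summable_derivSeries hS le_rfl (hρ h0m)
  have hftc : ∀ j, ∫ t in (0 : ℝ)..x, (derivative^[R + 1] (u j)).eval t =
      (derivative^[R] (u j)).eval x - (derivative^[R] (u j)).eval 0 := by
    intro j
    refine intervalIntegral.integral_eq_sub_of_hasDerivAt
      (f := fun t => (derivative^[R] (u j)).eval t) (fun t _ => ?_)
      ((Polynomial.continuous _).intervalIntegrable _ _)
    rw [Function.iterate_succ_apply']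
    exact Polynomial.hasDerivAt _ _
  have hsub : uIoc 0 x ⊆ Icc (-ρ) ρ := uIoc_subset_uIcc.trans (uIcc_subset_Icc h0m hx)
  have hint : ∫ t in (0 : ℝ)..x, derivSeries u (R + 1) t =
      ∑' j, ∫ t in (0 : ℝ)..x, (derivative^[R + 1] (u j)).eval t := by
    simp only [intervalIntegral.intervalIntegral_eq_integral_uIoc]
    rw [tsum_const_smul'']
    congr 1
    refine integral_tsum (fun j => (Polynomial.continuous _).aestronglyMeasurable) ?_
    refine ne_top_of_le_ne_top (hS (R + 1) le_rfl ρ h0 h1) ?_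
    exact ENNReal.tsum_le_tsum fun j => lintegral_mono_set hsub
  rw [hint]
  simp_rw [hftc]
  rw [hsx.tsum_sub hs0, derivSeries, derivSeries]
  ring

lemma absolutelyContinuousOnInterval_congr_add_const {F G : ℝ → ℝ} {a b c : ℝ}
    (hG : AbsolutelyContinuousOnInterval G a b) (h : ∀ x ∈ uIcc a b, F x = c + G x) :
    AbsolutelyContinuousOnInterval F a b := by
  rw [absolutelyContinuousOnInterval_iff] at hG ⊢
  intro ε hε
  obtain ⟨δ, hδ, hE⟩ := hG ε hε
  refine ⟨δ, hδ, fun E hEm hlt => ?_⟩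
  convert! hE E hEm hlt using 1
  refine Finset.sum_congr rfl fun i hi => ?_
  rw [h _ (hEm.1 i hi).1, h _ (hEm.1 i hi).2, dist_add_left]

lemma absolutelyContinuous_iteratedDeriv_derivSeries
    (hS : ∀ i ≤ R + 1, DerivLocallySummable u i) {a b : ℝ} (ha : -1 < a) (hab : a ≤ b)
    (hb : b < 1) :
    AbsolutelyContinuousOnInterval (iteratedDeriv R (derivSeries u 0)) a b := by
  obtain ⟨ρ, h0, h1, haρ, hbρ⟩ := exists_rho (a := a) (b := b) ⟨ha, by linarith⟩ ⟨by linarith, hb⟩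
  have hsub : uIcc a b ⊆ Icc (-ρ) ρ :=
    uIcc_subset_Icc (Ioo_subset_Icc_self haρ) (Ioo_subset_Icc_self hbρ)
  have hii : IntervalIntegrable (derivSeries u (R + 1)) volume (-ρ) ρ :=
    (intervalIntegrable_iff_integrableOn_Icc_of_le (by linarith)).2
      (integrableOn_derivSeries (hS (R + 1) le_rfl) h0 h1)
  have h2 := hii.absolutelyContinuousOnInterval_intervalIntegral (c := 0)
    (by rw [uIcc_of_le (by linarith)]; exact ⟨by linarith, h0.le⟩)
  refine absolutelyContinuousOnInterval_congr_add_const (c := derivSeries u R 0)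
    (h2.mono (by rwa [uIcc_of_le (by linarith : -ρ ≤ ρ)])) fun x hx => ?_
  have hx' := hsub hx
  rw [iteratedDeriv_derivSeries hS le_rfl ⟨by linarith [hx'.1], by linarith [hx'.2]⟩]
  exact derivSeries_eq_integral hS h0 h1 hx'

/-- The R-th derivative is an indefinite integral of the formal series of order R+1, so Lebesgue's
differentiation theorem identifies the actual derivative with that series almost everywhere. -/
lemma ae_hasSum_iteratedDeriv (hS : ∀ i ≤ R + 1, DerivLocallySummable u i) :
    ∀ᵐ x ∂mu, HasSum (fun j => (derivative^[R + 1] (u j)).eval x)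
      (iteratedDeriv (R + 1) (derivSeries u 0) x) := by
  -- The radii 1 - 1/(n+2) are positive from n = 0 on and exhaust (-1,1), so countably many null
  -- sets suffice.
  have key : ∀ n : ℕ, ∀ᵐ x : ℝ, x ∈ Ioo (-(1 - 1 / ((n : ℝ) + 2))) (1 - 1 / ((n : ℝ) + 2)) →
      HasSum (fun j => (derivative^[R + 1] (u j)).eval x)
      (iteratedDeriv (R + 1) (derivSeries u 0) x) := by
    intro n
    set ρ : ℝ := 1 - 1 / ((n : ℝ) + 2) with hρ
    have hn : (0 : ℝ) ≤ n := Nat.cast_nonneg n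
    have h1 : ρ < 1 := by rw [hρ]; have : 0 < 1 / ((n : ℝ) + 2) := by positivity
                          linarith
    have h0 : 0 < ρ := by
      rw [hρ, sub_pos, div_lt_one (by positivity)]; linarith
    have hii : IntervalIntegrable (derivSeries u (R + 1)) volume (-ρ) ρ :=
      (intervalIntegrable_iff_integrableOn_Icc_of_le (by linarith)).2
        (integrableOn_derivSeries (hS (R + 1) le_rfl) h0 h1)
    have h2 := hii.ae_hasDerivAt_integral
    have h3 := (ae_restrict_iff' measurableSet_Icc).1
      (ae_summable_derivSeries (hS (R + 1) le_rfl) h0 h1)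
    filter_upwards [h2, h3] with x hx hx3 hxI
    have hxI' := Ioo_subset_Icc_self hxI
    rw [uIcc_of_le (by linarith : -ρ ≤ ρ)] at hx
    have h4 := (hx hxI' 0 ⟨by linarith, h0.le⟩).const_add (derivSeries u R 0)
    have h5 : iteratedDeriv R (derivSeries u 0) =ᶠ[nhds x]
        fun x => derivSeries u R 0 + ∫ t in (0 : ℝ)..x, derivSeries u (R + 1) t := by
      filter_upwards [isOpen_Ioo.mem_nhds hxI] with y hy
      rw [iteratedDeriv_derivSeries hS le_rfl ⟨by linarith [hy.1], by linarith [hy.2]⟩]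
      exact derivSeries_eq_integral hS h0 h1 (Ioo_subset_Icc_self hy)
    rw [iteratedDeriv_succ, h5.deriv_eq, h4.deriv]
    exact (hx3 hxI').hasSum
  rw [mu_eq_restrict_Ioo, ae_restrict_iff' measurableSet_Ioo]
  filter_upwards [ae_all_iff.2 key] with x hx hxI
  obtain ⟨n, hn⟩ := exists_nat_one_div_lt (sub_pos.2 (abs_lt.2 hxI))
  have h2 : 1 / ((n : ℝ) + 2) ≤ 1 / ((n : ℝ) + 1) :=
    one_div_le_one_div_of_le (by positivity) (by linarith)
  exact hx n (abs_lt.1 (by linarith))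

end Series

/-! ### Cauchy condensation and the smooth representative -/

lemma sum_le_tsum_subtype {P : ℕ → Prop} (a : ℕ → ℝ≥0∞) (s : Finset ℕ) (hs : ∀ n ∈ s, P n) :
    ∑ n ∈ s, a n ≤ ∑' n : {n : ℕ // P n}, a n := by
  have h1 : ∑' n : {n : ℕ // P n}, a n = ∑' n, {n | P n}.indicator a n := tsum_subtype {n | P n} a
  rw [h1]
  refine le_trans (Finset.sum_le_sum fun n hn => ?_) (ENNReal.sum_le_tsum s)
  rw [indicator_of_mem (by exact hs n hn)]

lemma tsum_subtype_mono {P Q : ℕ → Prop} (a : ℕ → ℝ≥0∞) (h : ∀ n, P n → Q n) :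
    ∑' n : {n : ℕ // P n}, a n ≤ ∑' n : {n : ℕ // Q n}, a n := by
  have h1 : ∑' n : {n : ℕ // P n}, a n = ∑' n, {n | P n}.indicator a n := tsum_subtype {n | P n} a
  have h2 : ∑' n : {n : ℕ // Q n}, a n = ∑' n, {n | Q n}.indicator a n := tsum_subtype {n | Q n} a
  rw [h1, h2]
  exact ENNReal.tsum_le_tsum fun n => indicator_le_indicator_of_subset (fun n hn => h n hn)
    (fun _ => zero_le) n

lemma sum_Ioc_two_pow (a : ℕ → ℝ≥0∞) (J : ℕ) :
    ∑ j ∈ Finset.range J, ∑ n ∈ Finset.Ioc (2 ^ j) (2 ^ (j + 1)), a n =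
      ∑ n ∈ Finset.Ioc 1 (2 ^ J), a n := by
  induction J with
  | zero => simp
  | succ J ih =>
    rw [Finset.sum_range_succ, ih]
    exact Finset.sum_Ioc_consecutive a Nat.one_le_two_pow
      (Nat.pow_le_pow_right (by norm_num) (Nat.le_succ J))

/-- Cauchy condensation: the term of index j+1 is compared with the block (2^j, 2^(j+1)] of the
given series. -/
lemma tsum_two_pow_mul_ne_top {E : ℕ → ℝ≥0∞} (hE : Antitone E) (h1 : E 1 ≠ ∞) {s : ℕ} (hs : 1 ≤ s)
    (h : ∑' n : {n : ℕ // 1 ≤ n}, (s : ℝ≥0∞) * (n : ℝ≥0∞) ^ (s - 1) * E n < ∞) :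
    ∑' j : ℕ, (2 ^ j : ℝ≥0∞) ^ s * E (2 ^ j) ≠ ∞ := by
  rw [tsum_eq_zero_add' ENNReal.summable]
  refine ENNReal.add_ne_top.2 ⟨by simpa using h1, ?_⟩
  refine ne_top_of_le_ne_top (ENNReal.mul_ne_top (by finiteness : (2 : ℝ≥0∞) ^ s ≠ ∞) h.ne) ?_
  refine ENNReal.tsum_le_of_sum_range_le fun J => ?_
  have h2 : ∀ j ∈ Finset.range J, (2 ^ (j + 1) : ℝ≥0∞) ^ s * E (2 ^ (j + 1)) ≤
      2 ^ s * ∑ n ∈ Finset.Ioc (2 ^ j : ℕ) (2 ^ (j + 1)), (s : ℝ≥0∞) * (n : ℝ≥0∞) ^ (s - 1) * E n := by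
    intro j _
    have h3 := pow_mul_le_sum_Ioc hE hs (2 ^ (j + 1))
    rw [pow_succ 2 j, Nat.mul_div_cancel _ (by norm_num), ← pow_succ] at h3
    push_cast at h3
    refine h3.trans (mul_le_mul' le_rfl (Finset.sum_le_sum fun n _ => ?_))
    rw [mul_assoc]
    refine le_mul_of_one_le_left zero_le ?_
    exact_mod_cast hs
  refine (Finset.sum_le_sum h2).trans ?_
  rw [← Finset.mul_sum, sum_Ioc_two_pow fun n : ℕ => (s : ℝ≥0∞) * (n : ℝ≥0∞) ^ (s - 1) * E n]
  exact mul_le_mul' le_rfl (sum_le_tsum_subtype _ _ fun n hn => (Finset.mem_Ioc.1 hn).1.le)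

/-- The terms of the dyadic telescoping series with partial sums `q (2 ^ J)`. -/
noncomputable def dyadicTerm (q : ℕ → ℝ[X]) : ℕ → ℝ[X]
  | 0 => q 1
  | j + 1 => q (2 ^ (j + 1)) - q (2 ^ j)

lemma sum_dyadicTerm (q : ℕ → ℝ[X]) (J : ℕ) :
    ∑ j ∈ Finset.range (J + 1), dyadicTerm q j = q (2 ^ J) := by
  induction J with
  | zero => simp [dyadicTerm]
  | succ J ih => rw [Finset.sum_range_succ, ih, dyadicTerm]; ring

lemma tendsto_eval_of_hasSum {q : ℕ → ℝ[X]} {i : ℕ} {x y : ℝ}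
    (h : HasSum (fun j => (derivative^[i] (dyadicTerm q j)).eval x) y) :
    Filter.Tendsto (fun J => (derivative^[i] (q (2 ^ J))).eval x) Filter.atTop (nhds y) := by
  refine ((Filter.tendsto_add_atTop_iff_nat 1).2 h.tendsto_sum_nat).congr fun J => ?_
  rw [← sum_dyadicTerm q J, iterate_derivative_sum, eval_finsetSum]

namespace IsNearBest

variable {p : ℝ≥0∞} {f : ℝ → ℝ} {q : ℕ → ℝ[X]}

lemma tsum_dyadicTerm_ne_top (h : IsNearBest p f q) (hp : 1 ≤ p) (hf : MemLp f p mu) {r : ℕ}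
    (hr : 1 ≤ r)
    (hsum : ∑' n : {n : ℕ // 1 ≤ n}, (r : ℝ≥0∞) * (n : ℝ≥0∞) ^ (r - 1) * approxError n f p < ∞)
    {i : ℕ} (hi : i ≤ r) :
    ∑' j, eLpNorm (fun x => (derivative^[i] (dyadicTerm q j)).eval x * phi x ^ i) p mu ≠ ∞ := by
  have hE1 : approxError 1 f p ≠ ∞ := ((approxError_le_eLpNorm 1 f p).trans_lt hf.2).ne
  have h1 := tsum_two_pow_mul_ne_top (approxError_antitone f p) hE1 hr hsum
  rw [tsum_eq_zero_add' ENNReal.summable]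
  refine ENNReal.add_ne_top.2 ⟨?_, ?_⟩
  · refine ne_top_of_le_ne_top ?_ (eLpNorm_iterate_derivative_mul_phi_pow_le hp le_rfl i)
    refine ENNReal.mul_ne_top (by finiteness) (memLp_polynomial_eval _ p).2.ne
  · refine ne_top_of_le_ne_top (ENNReal.mul_ne_top (by finiteness : 4 * (6 : ℝ≥0∞) ^ i * 2 ^ r ≠ ∞)
      h1) ?_
    rw [← ENNReal.tsum_mul_left]
    refine ENNReal.tsum_le_tsum fun j => ?_
    refine (h.eLpNorm_derivative_sub_le hp hf.1 i Nat.one_le_two_pow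
      (Nat.pow_le_pow_right (by norm_num) (Nat.le_succ j))).trans ?_
    have h2 : ((2 ^ (j + 1) : ℕ) : ℝ≥0∞) ^ i ≤ 2 ^ r * (2 ^ j : ℝ≥0∞) ^ r := by
      rw [← mul_pow, ← pow_succ']
      push_cast
      exact pow_le_pow_right₀ (one_le_pow₀ (by norm_num)) hi
    calc _ ≤ 4 * 6 ^ i * (2 ^ r * (2 ^ j : ℝ≥0∞) ^ r * approxError (2 ^ j) f p) := by gcongr
      _ = _ := by ring

lemma exists_smooth_representative_of_pos (h : IsNearBest p f q) (hp : 1 ≤ p) (hf : MemLp f p mu)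
    (R : ℕ) (hsum : ∑' n : {n : ℕ // 1 ≤ n},
      ((R + 1 : ℕ) : ℝ≥0∞) * (n : ℝ≥0∞) ^ (R + 1 - 1) * approxError n f p < ∞) :
    ∃ g : ℝ → ℝ, g =ᵐ[mu] f ∧ MemB p (R + 1) g ∧ Measurable (iteratedDeriv (R + 1) g) ∧
      ∀ M : ℕ, 1 ≤ M →
        eLpNorm (fun x => (iteratedDeriv (R + 1) g x - (derivative^[R + 1] (q M)).eval x) *
          phi x ^ (R + 1)) p mu ≤ 6 ^ (R + 1) * (4 * 6 ^ (R + 1)) *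
          ((M : ℝ≥0∞) ^ (R + 1) * approxError M f p + ∑' n : {n : ℕ // M < n},
            ((R + 1 : ℕ) : ℝ≥0∞) * (n : ℝ≥0∞) ^ (R + 1 - 1) * approxError n f p) := by
  set r := R + 1 with hr
  set u := dyadicTerm q
  have hE1 : approxError 1 f p ≠ ∞ := ((approxError_le_eLpNorm 1 f p).trans_lt hf.2).ne
  have hS : ∀ i ≤ R + 1, DerivLocallySummable u i := fun i hi =>
    derivLocallySummable_of_eLpNorm hp (h.tsum_dyadicTerm_ne_top hp hf (by omega) hsum hi)
  set g := derivSeries u 0 with hg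
  have hmeas : Measurable (iteratedDeriv r g) := by
    rw [hr, iteratedDeriv_succ]
    exact measurable_deriv _
  have hlim : ∀ᵐ x ∂mu, Filter.Tendsto (fun J => (derivative^[r] (q (2 ^ J))).eval x) Filter.atTop
      (nhds (iteratedDeriv r g x)) := by
    filter_upwards [ae_hasSum_iteratedDeriv hS] with x hx
    exact tendsto_eval_of_hasSum hx
  have hbound : ∀ M : ℕ, 1 ≤ M →
      eLpNorm (fun x => (iteratedDeriv r g x - (derivative^[r] (q M)).eval x) * phi x ^ r) p mu ≤
      6 ^ r * (4 * 6 ^ r) * ((M : ℝ≥0∞) ^ r * approxError M f p + ∑' n : {n : ℕ // M < n},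
            (r : ℝ≥0∞) * (n : ℝ≥0∞) ^ (r - 1) * approxError n f p) := by
    intro M hM
    -- Fatou's lemma along q_(2^J), which needs only almost everywhere convergence and holds for p =
    -- ∞ as well.
    refine (Lp.eLpNorm_lim_le_liminf_eLpNorm
      (f := fun J x => (derivative^[r] (q (2 ^ J) - q M)).eval x * phi x ^ r)
      (fun J => (continuous_eval_mul_phi_pow _ r).aestronglyMeasurable) _ ?_).trans ?_
    · filter_upwards [hlim] with x hx
      simp only [iterate_derivative_sub, eval_sub]
      exact (hx.sub_const _).mul_const _
    -- A single J with 2^J ≥ M is enough, because the final bound does not depend on J.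
    · refine Filter.liminf_le_of_le (by isBoundedDefault) fun b hb => ?_
      have h2 : ∀ᶠ J : ℕ in Filter.atTop, M ≤ 2 ^ J :=
        (tendsto_pow_atTop_atTop_of_one_lt (by norm_num)).eventually_ge_atTop M
      obtain ⟨J, hJ, hJM⟩ := (hb.and h2).exists
      refine hJ.trans ((h.eLpNorm_derivative_sub_le_sum hp hf.1 r hM hJM).trans ?_)
      gcongr
      simp_rw [← mul_assoc]
      exact sum_le_tsum_subtype (fun n : ℕ => (r : ℝ≥0∞) * (n : ℝ≥0∞) ^ (r - 1) * approxError n f p)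
        _ fun n hn => (Finset.mem_Ioc.1 hn).1
  refine ⟨g, ?_, ⟨fun _ => ⟨?_, ?_⟩, ?_⟩, hmeas, hbound⟩
  -- The errors tend to 0 since they are dominated by the terms of the condensed series; hence the
  -- pointwise limit agrees with f almost everywhere.
  · have hconv : Filter.Tendsto (fun J : ℕ => 2 * approxError (2 ^ J) f p) Filter.atTop
        (nhds 0) := by
      have h2 := ENNReal.tendsto_atTop_zero_of_tsum_ne_top
        (tsum_two_pow_mul_ne_top (approxError_antitone f p) hE1 (by omega : 1 ≤ r) hsum)
      have h3 := ENNReal.Tendsto.const_mul (a := 2) h2 (Or.inr (by norm_num))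
      rw [mul_zero] at h3
      refine tendsto_of_tendsto_of_tendsto_of_le_of_le tendsto_const_nhds h3 (fun _ => zero_le)
        fun J => mul_le_mul' le_rfl (le_mul_of_one_le_left zero_le ?_)
      exact one_le_pow₀ (one_le_pow₀ (by norm_num))
    have h0 : eLpNorm (fun x => f x - g x) p mu = 0 := by
      refine le_antisymm ?_ zero_le
      refine (Lp.eLpNorm_lim_le_liminf_eLpNorm
        (f := fun J x => f x - (q (2 ^ J)).eval x)
        (fun J => hf.1.sub (Polynomial.continuous _).aestronglyMeasurable) _ ?_).trans ?_
      · filter_upwards [ae_mu_mem_Ioo] with x hx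
        have h2 := (summable_derivSeries (i := 0) hS (Nat.zero_le R) hx).hasSum
        exact (tendsto_eval_of_hasSum h2).const_sub _
      · exact (Filter.liminf_le_liminf (Filter.Eventually.of_forall fun J => h.le (2 ^ J))).trans_eq
          hconv.liminf_eq
    have hgm : AEStronglyMeasurable g mu := by
      rw [mu_eq_restrict_Ioo]
      exact (continuousOn_derivSeries hS (Nat.zero_le R)).aestronglyMeasurable measurableSet_Ioo
    change eLpNorm (f - g) p mu = 0 at h0
    rw [eLpNorm_eq_zero_iff (hf.1.sub hgm) (zero_lt_one.trans_le hp).ne'] at h0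
    filter_upwards [h0] with x hx
    exact (sub_eq_zero.1 hx).symm
  · exact contDiffOn_derivSeries hS R 0 (by omega)
  · exact fun a b ha hab hb => absolutelyContinuous_iteratedDeriv_derivSeries hS ha hab hb
  · refine ⟨(hmeas.mul (continuous_phi.measurable.pow_const r)).aestronglyMeasurable, ?_⟩
    have heq : (fun x => iteratedDeriv r g x * phi x ^ r) =
        (fun x => (iteratedDeriv r g x - (derivative^[r] (q 1)).eval x) * phi x ^ r) +
        fun x => (derivative^[r] (q 1)).eval x * phi x ^ r := by
      funext x
      simp only [Pi.add_apply]
      ring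
    rw [heq]
    have hm2 := (continuous_eval_mul_phi_pow (derivative^[r] (q 1)) r)
    refine (eLpNorm_add_le ?_ hm2.aestronglyMeasurable hp).trans_lt (ENNReal.add_lt_top.2 ⟨?_, ?_⟩)
    · exact ((hmeas.sub (Polynomial.continuous _).measurable).mul
        (continuous_phi.measurable.pow_const r)).aestronglyMeasurable
    · refine (hbound 1 le_rfl).trans_lt ?_
      have h2 := (tsum_subtype_mono
        (fun n : ℕ => (r : ℝ≥0∞) * (n : ℝ≥0∞) ^ (r - 1) * approxError n f p)
        (P := fun n => 1 < n) (Q := fun n => 1 ≤ n) (fun n hn => hn.le)).trans_lt hsum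
      refine ENNReal.mul_lt_top (by finiteness) (ENNReal.add_lt_top.2 ⟨?_, h2⟩)
      simpa using hE1.lt_top
    · refine (eLpNorm_iterate_derivative_mul_phi_pow_le hp le_rfl r).trans_lt ?_
      exact ENNReal.mul_lt_top (by finiteness) (memLp_polynomial_eval _ p).2

/-- The smooth representative of `f`, and the rate of approximation of its `r`-th derivative. -/
lemma exists_smooth_representative (h : IsNearBest p f q) (hp : 1 ≤ p) (hf : MemLp f p mu)
    (r : ℕ) (hsum : ∑' n : {n : ℕ // 1 ≤ n},
      (r : ℝ≥0∞) * (n : ℝ≥0∞) ^ (r - 1) * approxError n f p < ∞) :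
    ∃ g : ℝ → ℝ, g =ᵐ[mu] f ∧ MemB p r g ∧ Measurable (iteratedDeriv r g) ∧
      ∀ M : ℕ, 1 ≤ M →
        eLpNorm (fun x => (iteratedDeriv r g x - (derivative^[r] (q M)).eval x) *
          phi x ^ r) p mu ≤ 6 ^ r * (4 * 6 ^ r) *
          ((M : ℝ≥0∞) ^ r * approxError M f p + ∑' n : {n : ℕ // M < n},
            (r : ℝ≥0∞) * (n : ℝ≥0∞) ^ (r - 1) * approxError n f p) := by
  rcases r with _ | R
  · have hae := hf.1.ae_eq_mk
    -- For r = 0 only a measurable representative is needed, and the near-best property with its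
    -- factor 2 is the required estimate.
    refine ⟨hf.1.mk f, hae.symm, ⟨fun h => by omega, ?_⟩, ?_, fun M hM => ?_⟩
    · simpa using hf.ae_eq hae
    · simpa using hf.1.stronglyMeasurable_mk.measurable
    · have h1 : eLpNorm (fun x => (iteratedDeriv 0 (hf.1.mk f) x -
          (derivative^[0] (q M)).eval x) * phi x ^ 0) p mu =
          eLpNorm (fun x => f x - (q M).eval x) p mu := by
        refine eLpNorm_congr_ae ?_
        filter_upwards [hae] with x hx
        simp [hx]
      rw [h1]
      refine (h.le M).trans ?_
      simp only [pow_zero, one_mul, mul_one, Nat.cast_zero, zero_mul, tsum_zero, add_zero]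
      gcongr
      norm_num
  · exact h.exists_smooth_representative_of_pos hp hf R hsum

end IsNearBest

/-! ### The estimate of the modulus of smoothness -/

lemma weightedDiff_step_zero {k : ℕ} (hk : 1 ≤ k) (r : ℕ) (g : ℝ → ℝ) : weightedDiff k r 0 g = 0 := by
  funext x
  have h := diffMoment_eq_zero (k := k) (j := 0) hk
  simp only [diffMoment, pow_zero, mul_one] at h
  simp only [weightedDiff, symmDifference, zero_mul, mul_zero, add_zero, ← Finset.sum_mul, h,
    ite_self, Pi.zero_apply]

/-- From 1/t < M + 1 one gets 1 < tM + t ≤ tM + 1/2; this is where t ≤ 1/2 enters. -/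
lemma one_le_two_mul_ofReal_mul {t : ℝ} (ht : 0 < t) (ht2 : t ≤ 1 / 2) {M : ℕ}
    (hM : ⌊1 / t⌋₊ ≤ M) : (1 : ℝ≥0∞) ≤ 2 * (ENNReal.ofReal t * M) := by
  have h1 : 1 / t < M + 1 := (Nat.lt_floor_add_one _).trans_le (by exact_mod_cast Nat.succ_le_succ hM)
  rw [div_lt_iff₀ ht] at h1
  have h2 : (1 : ℝ) ≤ 2 * (t * M) := by nlinarith
  rw [← ENNReal.ofReal_natCast, ← ENNReal.ofReal_mul ht.le, show (2 : ℝ≥0∞) = ENNReal.ofReal 2 by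
    norm_num, ← ENNReal.ofReal_mul (by norm_num), ← ENNReal.ofReal_one]
  exact ENNReal.ofReal_le_ofReal h2

/-- Since 1 ≤ 2tM, a factor (2tM)^k may be inserted, trading M^r for t^k M^(k+r). If M ≥ 2N the
block (M/2, M] lies in [N, M]; otherwise M is comparable to N and the separate term at N absorbs it.
-/
lemma pow_mul_le_of_floor {E : ℕ → ℝ≥0∞} (hE : Antitone E) (k r : ℕ) {N M : ℕ} (hk : 1 ≤ k)
    {t : ℝ} (ht : 0 < t) (ht2 : t ≤ 1 / 2) (hM : M = max N ⌊1 / t⌋₊) :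
    (M : ℝ≥0∞) ^ r * E M ≤ 2 ^ k * 2 ^ (k + r) * (ENNReal.ofReal t ^ k *
      ((N : ℝ≥0∞) ^ (k + r) * E N + ∑ n ∈ Finset.Icc N M, (n : ℝ≥0∞) ^ (k + r - 1) * E n)) := by
  have h1 := one_le_two_mul_ofReal_mul ht ht2 (M := M) (by omega)
  have h2 : (M : ℝ≥0∞) ^ (k + r) * E M ≤ 2 ^ (k + r) *
      ((N : ℝ≥0∞) ^ (k + r) * E N + ∑ n ∈ Finset.Icc N M, (n : ℝ≥0∞) ^ (k + r - 1) * E n) := by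
    rcases lt_or_ge M (2 * N) with hMN | hMN
    · have h3 : (M : ℝ≥0∞) ≤ 2 * N := by exact_mod_cast hMN.le
      calc (M : ℝ≥0∞) ^ (k + r) * E M ≤ (2 * N : ℝ≥0∞) ^ (k + r) * E N :=
            mul_le_mul' (pow_le_pow_left' h3 _) (hE (by omega))
        _ = 2 ^ (k + r) * ((N : ℝ≥0∞) ^ (k + r) * E N) := by rw [mul_pow]; ring
        _ ≤ _ := mul_le_mul' le_rfl le_self_add
    · refine (pow_mul_le_sum_Ioc hE (by omega : 1 ≤ k + r) M).trans (mul_le_mul' le_rfl ?_)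
      refine le_trans (Finset.sum_le_sum_of_subset fun n hn => ?_) le_add_self
      rw [Finset.mem_Ioc] at hn
      rw [Finset.mem_Icc]
      omega
  calc (M : ℝ≥0∞) ^ r * E M ≤ (2 * (ENNReal.ofReal t * M)) ^ k * ((M : ℝ≥0∞) ^ r * E M) :=
        le_mul_of_one_le_left zero_le (one_le_pow₀ h1)
    _ = 2 ^ k * ENNReal.ofReal t ^ k * ((M : ℝ≥0∞) ^ (k + r) * E M) := by
        rw [mul_pow, mul_pow, pow_add]; ring
    _ ≤ 2 ^ k * ENNReal.ofReal t ^ k * (2 ^ (k + r) *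
        ((N : ℝ≥0∞) ^ (k + r) * E N + ∑ n ∈ Finset.Icc N M, (n : ℝ≥0∞) ^ (k + r - 1) * E n)) :=
        mul_le_mul' le_rfl h2
    _ = _ := by ring

lemma natCast_le_iff_le_floor {t : ℝ} (ht : 0 < t) (n : ℕ) :
    (n : ℝ≥0∞) ≤ 1 / ENNReal.ofReal t ↔ n ≤ ⌊1 / t⌋₊ := by
  rw [Nat.le_floor_iff (by positivity), ← ENNReal.ofReal_natCast, one_div, ← ENNReal.ofReal_inv_of_pos ht,
    ENNReal.ofReal_le_ofReal_iff (by positivity), one_div]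

/-- The constant in the bound for differences of polynomials. -/
noncomputable def polyConst (k r : ℕ) : ℝ≥0∞ :=
  ENNReal.ofReal (2 ^ (k + 1) * Real.exp (6 * k) * 6 ^ r) * 4

/-- The constant in the bound for the difference of `f` and its approximants. -/
noncomputable def diffConst (k r : ℕ) : ℝ≥0∞ :=
  2 ^ (k + 1) * (6 ^ r * (4 * 6 ^ r)) * (2 ^ k * 2 ^ (k + r)) +
    6 ^ (k + r) * polyConst k r * (k + r + 1 : ℕ)

lemma polyConst_ne_top (k r : ℕ) : polyConst k r ≠ ∞ := by unfold polyConst; finiteness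

lemma diffConst_ne_top (k r : ℕ) : diffConst k r ≠ ∞ := by
  have := polyConst_ne_top k r
  unfold diffConst
  finiteness

lemma IsNearBest.eLpNorm_weightedDiff_le {p : ℝ≥0∞} {f : ℝ → ℝ} {q : ℕ → ℝ[X]}
    (h : IsNearBest p f q) (hp : 1 ≤ p) (hf : MemLp f p mu) {k : ℕ} (hk : 1 ≤ k) (r : ℕ) {G : ℝ → ℝ}
    (hG : Measurable G)
    (hGq : ∀ M : ℕ, 1 ≤ M →
        eLpNorm (fun x => (G x - (derivative^[r] (q M)).eval x) *
          phi x ^ r) p mu ≤ 6 ^ r * (4 * 6 ^ r) *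
          ((M : ℝ≥0∞) ^ r * approxError M f p + ∑' n : {n : ℕ // M < n},
            (r : ℝ≥0∞) * (n : ℝ≥0∞) ^ (r - 1) * approxError n f p))
    {N : ℕ} (hN : 1 ≤ N) {t : ℝ} (ht : 0 < t) (ht2 : t ≤ 1 / 2) {δ : ℝ} (hδ : δ ∈ Icc 0 t) :
    eLpNorm (weightedDiff k r δ G) p mu ≤
      diffConst k r * ((∑' n : {n : ℕ // max (N : ℝ≥0∞) (1 / ENNReal.ofReal t) < n},
        (r : ℝ≥0∞) * (n : ℝ≥0∞) ^ (r - 1) * approxError n f p) +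
        ENNReal.ofReal t ^ k * ((N : ℝ≥0∞) ^ (k + r) * approxError N f p +
        ∑' n : {n : ℕ // N ≤ n ∧ (n : ℝ≥0∞) ≤ max (1 / ENNReal.ofReal t) N},
          (n : ℝ≥0∞) ^ (k + r - 1) * approxError n f p)) +
      eLpNorm (weightedDiff k r δ fun x => (derivative^[r] (q N)).eval x) p mu := by
  set E : ℕ → ℝ≥0∞ := fun n => approxError n f p with hEdef
  have hE : Antitone E := approxError_antitone f p
  -- The integers n ≤ M are exactly those with n ≤ max(N, 1/t), so M separates the two sums of the
  -- theorem.
  set M := max N ⌊1 / t⌋₊ with hM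
  have hNM : N ≤ M := le_max_left _ _
  set T := ENNReal.ofReal t with hT
  set S1 := ∑' n : {n : ℕ // max (N : ℝ≥0∞) (1 / T) < n},
        (r : ℝ≥0∞) * (n : ℝ≥0∞) ^ (r - 1) * E n with hS1
  set S2 := ∑' n : {n : ℕ // N ≤ n ∧ (n : ℝ≥0∞) ≤ max (1 / T) N},
          (n : ℝ≥0∞) ^ (k + r - 1) * E n with hS2
  set X := (N : ℝ≥0∞) ^ (k + r) * E N with hX
  have hmax : ∀ n : ℕ, (n : ℝ≥0∞) ≤ max (1 / T) N ↔ n ≤ M := by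
    intro n
    rw [le_max_iff, natCast_le_iff_le_floor ht, Nat.cast_le, hM, le_max_iff, or_comm]
  have htail : ∑' n : {n : ℕ // M < n}, (r : ℝ≥0∞) * (n : ℝ≥0∞) ^ (r - 1) * E n ≤ S1 := by
    refine tsum_subtype_mono (fun n : ℕ => (r : ℝ≥0∞) * (n : ℝ≥0∞) ^ (r - 1) * E n) fun n hn => ?_
    rw [max_comm, ← not_le, hmax, not_le]
    exact hn
  have hIcc : ∑ n ∈ Finset.Icc N M, (n : ℝ≥0∞) ^ (k + r - 1) * E n ≤ S2 := by
    refine sum_le_tsum_subtype (fun n : ℕ => (n : ℝ≥0∞) ^ (k + r - 1) * E n) _ fun n hn => ?_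
    rw [Finset.mem_Icc] at hn
    exact ⟨hn.1, (hmax n).2 hn.2⟩
  have hδT : ENNReal.ofReal δ ≤ T := ENNReal.ofReal_le_ofReal hδ.2
  have hsplit : G = fun x => (G x - (derivative^[r] (q M)).eval x) +
      ((derivative^[r] (q M - q N)).eval x + (derivative^[r] (q N)).eval x) := by
    funext x
    simp only [iterate_derivative_sub, eval_sub]
    ring
  have hD : ∀ Q : ℝ[X], Measurable fun x => (derivative^[r] Q).eval x := fun Q =>
    (Polynomial.continuous _).measurable
  have hm1 : Measurable fun x => G x - (derivative^[r] (q M)).eval x := hG.sub (hD _)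
  have htri : eLpNorm (weightedDiff k r δ G) p mu ≤
      eLpNorm (weightedDiff k r δ fun x => G x - (derivative^[r] (q M)).eval x) p mu +
      (eLpNorm (weightedDiff k r δ fun x => (derivative^[r] (q M - q N)).eval x) p mu +
      eLpNorm (weightedDiff k r δ fun x => (derivative^[r] (q N)).eval x) p mu) := by
    conv_lhs => rw [hsplit]
    refine (eLpNorm_weightedDiff_add_le hp k r δ hm1 ((hD _).add (hD _))).trans ?_
    exact add_le_add le_rfl (eLpNorm_weightedDiff_add_le hp k r δ (hD _) (hD _))
  have hT1 : eLpNorm (weightedDiff k r δ fun x => G x - (derivative^[r] (q M)).eval x) p mu ≤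
      2 ^ (k + 1) * (6 ^ r * (4 * 6 ^ r)) * (2 ^ k * 2 ^ (k + r)) * (S1 + T ^ k * (X + S2)) := by
    refine (_root_.eLpNorm_weightedDiff_le hp k r hδ.1 hm1).trans ?_
    refine (mul_le_mul' le_rfl (hGq M (hN.trans hNM))).trans ?_
    rw [← mul_assoc, mul_assoc _ (2 ^ k * 2 ^ (k + r) : ℝ≥0∞)]
    refine mul_le_mul' le_rfl ?_
    have h1 := pow_mul_le_of_floor hE k r hk ht ht2 hM
    have h2 : (1 : ℝ≥0∞) ≤ 2 ^ k * 2 ^ (k + r) := by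
      rw [← pow_add]; exact one_le_pow₀ (by norm_num)
    calc _ ≤ 2 ^ k * 2 ^ (k + r) * (T ^ k * (X + S2)) + 2 ^ k * 2 ^ (k + r) * S1 := by
          refine add_le_add (h1.trans ?_) (htail.trans (le_mul_of_one_le_left zero_le h2))
          exact mul_le_mul' le_rfl (mul_le_mul' le_rfl (add_le_add le_rfl hIcc))
      _ = _ := by ring
  have hT2 : eLpNorm (weightedDiff k r δ fun x => (derivative^[r] (q M - q N)).eval x) p mu ≤
      6 ^ (k + r) * polyConst k r * (k + r + 1 : ℕ) * (S1 + T ^ k * (X + S2)) := by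
    refine (h.eLpNorm_weightedDiff_sub_le_sum hp hf.1 k r hδ.1 hN hNM).trans ?_
    rw [← Finset.mul_sum]
    have h1 : ∑ n ∈ Finset.Ioc N (M / 2), (n : ℝ≥0∞) ^ (k + r - 1) * E n ≤ S2 := by
      refine le_trans (Finset.sum_le_sum_of_subset fun n hn => ?_) hIcc
      rw [Finset.mem_Ioc] at hn
      rw [Finset.mem_Icc]
      omega
    have h2 : ((k + r : ℕ) : ℝ≥0∞) ≤ (k + r + 1 : ℕ) := by exact_mod_cast Nat.le_succ _
    have h3 : (1 : ℝ≥0∞) ≤ (k + r + 1 : ℕ) := by exact_mod_cast Nat.le_add_left 1 _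
    calc _ ≤ 6 ^ (k + r) * (polyConst k r * T ^ k) *
          ((k + r + 1 : ℕ) * X + (k + r + 1 : ℕ) * S2) := by
          refine mul_le_mul' (mul_le_mul' le_rfl (mul_le_mul' le_rfl
            (pow_le_pow_left' hδT k))) ?_
          exact add_le_add (le_mul_of_one_le_left zero_le h3) (mul_le_mul' h2 h1)
      _ = 6 ^ (k + r) * polyConst k r * (k + r + 1 : ℕ) * (T ^ k * (X + S2)) := by ring
      _ ≤ _ := mul_le_mul' le_rfl le_add_self
  refine htri.trans ?_
  rw [← add_assoc]
  refine add_le_add ((add_le_add hT1 hT2).trans_eq ?_) le_rfl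
  rw [diffConst]
  ring

/-- The difference annihilates the r-th derivative of q_(k+r), so only q_N - q_(k+r) contributes,
with norm at most 4 E_(k+r). -/
lemma IsNearBest.eLpNorm_weightedDiff_le_of_le {p : ℝ≥0∞} {f : ℝ → ℝ} {q : ℕ → ℝ[X]}
    (h : IsNearBest p f q) (hp : 1 ≤ p) (hf : MemLp f p mu) {k : ℕ} (hk : 1 ≤ k) (r : ℕ) {N : ℕ}
    (hN : k + r ≤ N) {t δ : ℝ} (hδ : δ ∈ Icc 0 t) :
    eLpNorm (weightedDiff k r δ fun x => (derivative^[r] (q N)).eval x) p mu ≤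
      polyConst k r * (N : ℝ≥0∞) ^ (k + r) * (ENNReal.ofReal t ^ k * approxError (k + r) f p) := by
  have hsplit : (fun x => (derivative^[r] (q N)).eval x) = fun x =>
      (derivative^[r] (q N - q (k + r))).eval x + (derivative^[r] (q (k + r))).eval x := by
    funext x
    simp only [iterate_derivative_sub, eval_sub]
    ring
  rw [hsplit]
  refine (eLpNorm_weightedDiff_add_le hp k r δ (Polynomial.continuous _).measurable
    (Polynomial.continuous _).measurable).trans ?_
  rw [weightedDiff_polynomial_eq_zero hk δ (h.mem (k + r)), eLpNorm_zero, add_zero]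
  refine (eLpNorm_weightedDiff_polynomial_le hp k r hδ.1
    (h.natDegree_sub_lt (by omega : 1 ≤ k + r) hN)).trans ?_
  calc _ ≤ ENNReal.ofReal (2 ^ (k + 1) * Real.exp (6 * k) * 6 ^ r) * (ENNReal.ofReal t ^ k *
        (N : ℝ≥0∞) ^ (k + r) * (4 * approxError (k + r) f p)) := by
        refine mul_le_mul' le_rfl (mul_le_mul' (mul_le_mul' (pow_le_pow_left'
          (ENNReal.ofReal_le_ofReal hδ.2) k) le_rfl) (h.eLpNorm_sub_le hp hf.1 hN))
    _ = _ := by rw [polyConst]; ring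

theorem theorem3 (p : ℝ≥0∞) (hp : 1 ≤ p) (k : ℕ) (hk : 1 ≤ k) (r : ℕ) :
    ∃ c : ℝ≥0, ∀ N : ℕ, 1 ≤ N → ∃ cN : ℝ≥0, ∀ f : ℝ → ℝ, MemLp f p mu →
      (∑' n : {n : ℕ // 1 ≤ n},
        (r : ℝ≥0∞) * (n : ℝ≥0∞) ^ (r - 1) * approxError n f p) < ⊤ →
      ∃ g : ℝ → ℝ, g =ᵐ[mu] f ∧ MemB p r g ∧
        ∀ t ∈ Icc (0 : ℝ) (1 / 2),
          (modulus k r p (iteratedDeriv r g) t ≤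
              c * (∑' n : {n : ℕ // max (N : ℝ≥0∞) (1 / ENNReal.ofReal t) < n},
                (r : ℝ≥0∞) * (n : ℝ≥0∞) ^ (r - 1) * approxError n f p)
              + c * ENNReal.ofReal t ^ k *
                (∑' n : {n : ℕ // N ≤ n ∧ (n : ℝ≥0∞) ≤ max (1 / ENNReal.ofReal t) N},
                  (n : ℝ≥0∞) ^ (k + r - 1) * approxError n f p)
              + cN * ENNReal.ofReal t ^ k * approxError (k + r) f p) ∧
          (N ≤ k + r →
            modulus k r p (iteratedDeriv r g) t ≤
              c * (∑' n : {n : ℕ // max (N : ℝ≥0∞) (1 / ENNReal.ofReal t) < n},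
                (r : ℝ≥0∞) * (n : ℝ≥0∞) ^ (r - 1) * approxError n f p)
              + c * ENNReal.ofReal t ^ k *
                (∑' n : {n : ℕ // N ≤ n ∧ (n : ℝ≥0∞) ≤ max (1 / ENNReal.ofReal t) N},
                  (n : ℝ≥0∞) ^ (k + r - 1) * approxError n f p)) := by
  have hctop : diffConst k r * (k + r + 1 : ℕ) ≠ ∞ :=
    ENNReal.mul_ne_top (diffConst_ne_top k r) (by finiteness)
  refine ⟨(diffConst k r * (k + r + 1 : ℕ)).toNNReal, fun N hN => ?_⟩
  rw [ENNReal.coe_toNNReal hctop]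
  have hcNtop : (diffConst k r + polyConst k r) * (N : ℝ≥0∞) ^ (k + r) ≠ ∞ :=
    ENNReal.mul_ne_top (ENNReal.add_ne_top.2 ⟨diffConst_ne_top k r, polyConst_ne_top k r⟩)
      (by finiteness)
  refine ⟨((diffConst k r + polyConst k r) * (N : ℝ≥0∞) ^ (k + r)).toNNReal, fun f hf hsum => ?_⟩
  rw [ENNReal.coe_toNNReal hcNtop]
  choose q hqm hqe using exists_near_best hp hf
  have hq : IsNearBest p f q := ⟨hqm, hqe⟩
  obtain ⟨g, hgf, hgB, hgm, hgq⟩ := hq.exists_smooth_representative hp hf r hsum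
  refine ⟨g, hgf, hgB, fun t ht => ?_⟩
  have h3 : (1 : ℝ≥0∞) ≤ (k + r + 1 : ℕ) := by exact_mod_cast Nat.le_add_left 1 _
  rcases ht.1.eq_or_lt with rfl | ht0
  · have hmod : modulus k r p (iteratedDeriv r g) 0 = 0 := by
      refine le_antisymm (iSup₂_le fun δ hδ => ?_) zero_le
      obtain rfl : δ = 0 := le_antisymm hδ.2 hδ.1
      change eLpNorm (weightedDiff k r 0 (iteratedDeriv r g)) p mu ≤ 0
      rw [weightedDiff_step_zero hk, eLpNorm_zero]
    rw [hmod]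
    exact ⟨zero_le, fun _ => zero_le⟩
  set S1 := ∑' n : {n : ℕ // max (N : ℝ≥0∞) (1 / ENNReal.ofReal t) < n},
        (r : ℝ≥0∞) * (n : ℝ≥0∞) ^ (r - 1) * approxError n f p with hS1
  set S2 := ∑' n : {n : ℕ // N ≤ n ∧ (n : ℝ≥0∞) ≤ max (1 / ENNReal.ofReal t) N},
          (n : ℝ≥0∞) ^ (k + r - 1) * approxError n f p with hS2
  have hmain : ∀ δ ∈ Icc 0 t, eLpNorm (weightedDiff k r δ (iteratedDeriv r g)) p mu ≤
      diffConst k r * (S1 + ENNReal.ofReal t ^ k *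
        ((N : ℝ≥0∞) ^ (k + r) * approxError N f p + S2)) +
      eLpNorm (weightedDiff k r δ fun x => (derivative^[r] (q N)).eval x) p mu :=
    fun δ hδ => hq.eLpNorm_weightedDiff_le hp hf hk r hgm hgq hN ht0 ht.2 hδ
  have hsmall : N ≤ k + r → modulus k r p (iteratedDeriv r g) t ≤
      diffConst k r * (k + r + 1 : ℕ) * S1 +
        diffConst k r * (k + r + 1 : ℕ) * ENNReal.ofReal t ^ k * S2 := by
    intro hNkr
    refine iSup₂_le fun δ hδ => (hmain δ hδ).trans ?_
    rw [weightedDiff_polynomial_eq_zero hk δ (degreeLT_mono hNkr (hq.mem N)), eLpNorm_zero,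
      add_zero]
    -- The index n = N always belongs to the second sum, and the surplus factor N is at most k + r;
    -- so the constant stays free of N.
    have hX : (N : ℝ≥0∞) ^ (k + r) * approxError N f p ≤ (k + r : ℕ) * S2 := by
      have h1 := sum_le_tsum_subtype (P := fun n : ℕ => N ≤ n ∧
        (n : ℝ≥0∞) ≤ max (1 / ENNReal.ofReal t) N)
        (fun n : ℕ => (n : ℝ≥0∞) ^ (k + r - 1) * approxError n f p) {N} (fun n hn => by
          rw [Finset.mem_singleton] at hn
          subst hn
          exact ⟨le_rfl, le_max_right _ _⟩)
      rw [Finset.sum_singleton] at h1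
      calc _ = (N : ℝ≥0∞) * ((N : ℝ≥0∞) ^ (k + r - 1) * approxError N f p) := by
            rw [← mul_assoc, ← pow_succ', Nat.sub_add_cancel (by omega)]
        _ ≤ (k + r : ℕ) * S2 := mul_le_mul' (by exact_mod_cast hNkr) h1
    calc _ ≤ diffConst k r * ((k + r + 1 : ℕ) * S1 + ENNReal.ofReal t ^ k *
          ((k + r : ℕ) * S2 + S2)) :=
          mul_le_mul' le_rfl (add_le_add (le_mul_of_one_le_left zero_le h3)
            (mul_le_mul' le_rfl (add_le_add hX le_rfl)))
      _ = _ := by push_cast; ring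
  refine ⟨?_, hsmall⟩
  rcases le_or_gt N (k + r) with hNkr | hNkr
  · exact (hsmall hNkr).trans le_self_add
  -- For N > k + r, monotonicity replaces E_N by E_(k+r), and all factors N^(k+r) go into c(N).
  · refine iSup₂_le fun δ hδ => (hmain δ hδ).trans ?_
    have h4 := hq.eLpNorm_weightedDiff_le_of_le hp hf hk r hNkr.le hδ
    have h5 : approxError N f p ≤ approxError (k + r) f p := approxError_antitone f p hNkr.le
    calc _ ≤ diffConst k r * ((k + r + 1 : ℕ) * S1 + ENNReal.ofReal t ^ k *
          ((N : ℝ≥0∞) ^ (k + r) * approxError (k + r) f p + (k + r + 1 : ℕ) * S2)) +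
          polyConst k r * (N : ℝ≥0∞) ^ (k + r) *
            (ENNReal.ofReal t ^ k * approxError (k + r) f p) :=
          add_le_add (mul_le_mul' le_rfl (add_le_add (le_mul_of_one_le_left zero_le h3)
            (mul_le_mul' le_rfl (add_le_add (mul_le_mul' le_rfl h5)
              (le_mul_of_one_le_left zero_le h3))))) h4
      _ = _ := by ring
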